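/- A rooted ordered tree is a root together with a finite (possibly empty) ordered list of branches, which are again rooted ordered trees; $|T|$ is the number of vertices of $T$. Let $\sigma(T)$ be the number of independent vertex subsets of $T$ (including $\emptyset$) and $\sigma_2(T)$ the number of those not containing the root. Let $Z(T)$ be the number of independent edge subsets (matchings) of $T$ (including $\emptyset$) and $Z_2(T)$ the number of those that do not cover the root. Put $$\operatorname{SZ}_{22}(z)=\sum_T\sigma_2(T)Z_2(T)z^{|T|},\qquad \operatorname{SZ}(z)=\sum_T\sigma(T)Z(T)z^{|T|},$$ the sums being over all rooted ordered trees. Then $s=\operatorname{SZ}_{22}(z)$ satisfies, as a formal power series, the equation $$s^{10}+2zs^8-3zs^7+z^2s^6-4z^2s^5+3z^2s^4-z^3s^3+2z^3s^2-z^3s+z^4=0 .$$ There is a real number $z_0\approx0.0982673$ such that both series converge absolutely for $|z|<z_0$, and both sums continue analytically to $\{|z|<z_0+\varepsilon\}\setminus[z_0,\infty)$ for some $\varepsilon>0$ and have a square-root singularity at $z_0$: near $z_0$, off $[z_0,\infty)$, each continuation equals $g(z)-h(z)\sqrt{1-z/z_0}$ (principal branch) with $g,h$ analytic at $z_0$ and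 $h(z_0)\neq0$. The leading terms are $$\operatorname{SZ}_{22}(z)\sim a-b\sqrt{1-z/z_0},\qquad \operatorname{SZ}(z)\sim A-B\sqrt{1-z/z_0}\qquad(z\to z_0),$$ that is, $(g(z_0),h(z_0))=(a,b)$ for $\operatorname{SZ}_{22}$ and $(A,B)$ for $\operatorname{SZ}$, where $a\approx0.171502$, $b\approx0.138532$, $A\approx0.427020$, $B\approx0.462827$. Consequently, if $T_n$ is uniformly distributed on the rooted ordered trees with $n$ vertices and $\sigma_n=\sigma(T_n)$, $Z_n=Z(T_n)$, then, as $n\to\infty$, $$E(\sigma_nZ_n)\sim C\,\kappa^n,\qquad C=2B\approx0.92565,\quad \kappa=\frac1{4z_0}\approx2.54408 .$$ All decimals are correct to within half a unit of the last digit given. -/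

import Mathlib

open Filter Topology Asymptotics

/-- Finite rooted ordered (plane) trees: a root together with the finite, possibly empty, ordered
list of its branches. -/
inductive PlaneTree : Type
  | node (branches : List PlaneTree) : PlaneTree

namespace PlaneTree

/-- The vertices of a plane tree: the root, and the vertices of each branch. -/
inductive Vertex : PlaneTree → Type
  | root (cs : List PlaneTree) : Vertex (node cs)
  | inBranch {cs : List PlaneTree} (i : Fin cs.length) (v : Vertex (cs.get i)) : Vertex (node cs)

/-- The root of a plane tree, as a vertex. -/
def rootOf : (T : PlaneTree) → Vertex T
  | node cs => Vertex.root cs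

/-- `IsParent u v`: the vertex `u` is the parent of the vertex `v`. -/
inductive IsParent : {T : PlaneTree} → Vertex T → Vertex T → Prop
  | root {cs : List PlaneTree} (i : Fin cs.length) :
      IsParent (Vertex.root cs) (Vertex.inBranch i (rootOf (cs.get i)))
  | inBranch {cs : List PlaneTree} (i : Fin cs.length) {u v : Vertex (cs.get i)} :
      IsParent u v → IsParent (Vertex.inBranch i u) (Vertex.inBranch i v)

/-- The underlying graph of a plane tree: edges join parents and children. -/
def graph (T : PlaneTree) : SimpleGraph (Vertex T) :=
  SimpleGraph.fromRel IsParent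

/-- The number `|T|` of vertices of `T`. -/
noncomputable def size (T : PlaneTree) : ℕ := Nat.card (Vertex T)

/-- A vertex is the root or a vertex of one of the branches. -/
def vertexEquiv (cs : List PlaneTree) :
    Vertex (node cs) ≃ Option (Σ i : Fin cs.length, Vertex (cs.get i)) where
  toFun v := match v with
    | Vertex.root _ => none
    | Vertex.inBranch i v => some ⟨i, v⟩
  invFun v := match v with
    | none => Vertex.root cs
    | some ⟨i, v⟩ => Vertex.inBranch i v
  left_inv v := by cases v <;> rfl
  right_inv v := by rcases v with _ | ⟨i, v⟩ <;> rfl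

theorem finite_vertex : (T : PlaneTree) → Finite (Vertex T)
  | node cs => by
    have : ∀ i : Fin cs.length, Finite (Vertex (cs.get i)) := fun i => finite_vertex (cs.get i)
    exact Finite.of_equiv _ (vertexEquiv cs).symm
termination_by T => sizeOf T
decreasing_by
  have := List.sizeOf_get cs i
  simp only [node.sizeOf_spec]
  omega

instance (T : PlaneTree) : Finite (Vertex T) := finite_vertex T

theorem size_node (cs : List PlaneTree) :
    size (node cs) = (∑ i : Fin cs.length, size (cs.get i)) + 1 := by
  unfold size
  rw [Nat.card_congr (vertexEquiv cs), Finite.card_option, Nat.card_sigma]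

theorem size_pos (T : PlaneTree) : 0 < size T := by
  obtain ⟨cs⟩ := T
  rw [size_node]
  omega

theorem finite_size_le (n : ℕ) : {T : PlaneTree | size T ≤ n}.Finite := by
  induction n with
  | zero =>
    refine Set.Finite.subset Set.finite_empty fun T hT => ?_
    have := size_pos T
    simp only [Set.mem_ofPred_eq] at hT
    omega
  | succ n ih =>
    have : Finite {T : PlaneTree | size T ≤ n} := ih
    have hfin := List.finite_length_le {T : PlaneTree | size T ≤ n} n
    refine (hfin.image fun l => node (l.map Subtype.val)).subset ?_
    rintro ⟨cs⟩ hT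
    simp only [Set.mem_ofPred_eq, size_node] at hT
    have hle : ∀ T ∈ cs, size T ≤ n := by
      intro T hmem
      obtain ⟨i, rfl⟩ := List.get_of_mem hmem
      have := Finset.single_le_sum (f := fun i : Fin cs.length => size (cs.get i))
        (fun _ _ => Nat.zero_le _) (Finset.mem_univ i)
      omega
    have hlen : cs.length ≤ n := by
      have : ∑ _i : Fin cs.length, 1 ≤ ∑ i : Fin cs.length, size (cs.get i) :=
        Finset.sum_le_sum fun i _ => size_pos _
      simp only [Finset.sum_const, Finset.card_univ, Fintype.card_fin, smul_eq_mul, mul_one] at this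
      omega
    exact ⟨cs.attach.map fun T => ⟨T.1, hle T.1 T.2⟩, by simpa using hlen, by simp⟩

/-- The finite set of all plane trees with `n` vertices. -/
noncomputable def treesOfSize (n : ℕ) : Finset PlaneTree :=
  Set.Finite.toFinset (s := {T : PlaneTree | size T = n})
    ((finite_size_le n).subset fun _ h => le_of_eq h)

/-- A set of edges of the tree, no two of which share a vertex (a matching). -/
def IsIndepEdgeSet (T : PlaneTree) (M : Set (Sym2 (Vertex T))) : Prop :=
  M ⊆ T.graph.edgeSet ∧ M.Pairwise fun e f => ∀ v, v ∈ e → v ∉ f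

/-- The Merrifield–Simmons index: the number of independent vertex subsets. -/
noncomputable def sigma (T : PlaneTree) : ℕ :=
  Nat.card {s : Set (Vertex T) // T.graph.IsIndepSet s}

/-- The number of independent vertex subsets that do not contain the root. -/
noncomputable def sigma₂ (T : PlaneTree) : ℕ :=
  Nat.card {s : Set (Vertex T) // T.graph.IsIndepSet s ∧ rootOf T ∉ s}

/-- The Hosoya index: the number of independent edge subsets. -/
noncomputable def hosoya (T : PlaneTree) : ℕ :=
  Nat.card {M : Set (Sym2 (Vertex T)) // T.IsIndepEdgeSet M}

/-- The number of independent edge subsets that do not cover the root. -/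
noncomputable def hosoya₂ (T : PlaneTree) : ℕ :=
  Nat.card {M : Set (Sym2 (Vertex T)) // T.IsIndepEdgeSet M ∧ ∀ e ∈ M, rootOf T ∉ e}

/-- The expectation of `X T`, for `T` uniformly random among the plane trees with `n` vertices. -/
noncomputable def expectation (X : PlaneTree → ℝ) (n : ℕ) : ℝ :=
  (∑ T ∈ treesOfSize n, X T) / (treesOfSize n).card

/-- The formal generating function `∑ w(T) z ^ |T|` over all plane trees. -/
noncomputable def genFun (w : PlaneTree → ℕ) : PowerSeries ℤ :=
  PowerSeries.mk fun n => ∑ T ∈ treesOfSize n, (w T : ℤ)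

/-- The generating function `∑ w(T) z ^ |T|` converges (absolutely) for `|z| < z₀`, has a
square-root singularity at `z₀` with `f(z) ~ a - b √(1 - z / z₀)`, `b ≠ 0`, and no other singularity
in some disc `|z| < z₀ + ε`: its sum continues analytically to that disc slit along `[z₀, ∞)`,
and near `z₀` the continuation is `g(z) - h(z) √(1 - z / z₀)` (principal branch), where `g` and `h`
are analytic at `z₀`, `g(z₀) = a` and `h(z₀) = b`. -/
def HasDominantSqrtSingularity (w : PlaneTree → ℕ) (z₀ a b : ℝ) : Prop :=
  0 < z₀ ∧ b ≠ 0 ∧ ∃ (ε : ℝ) (f g h : ℂ → ℂ), 0 < ε ∧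
    (∀ z : ℂ, ‖z‖ < z₀ → HasSum (fun T : PlaneTree => (w T : ℂ) * z ^ T.size) (f z)) ∧
    AnalyticOnNhd ℂ f {z : ℂ | ‖z‖ < z₀ + ε ∧ ¬ (z.im = 0 ∧ z₀ ≤ z.re)} ∧
    AnalyticAt ℂ g z₀ ∧ AnalyticAt ℂ h z₀ ∧ g z₀ = a ∧ h z₀ = b ∧
    ∀ᶠ z in 𝓝 (z₀ : ℂ), ¬ (z.im = 0 ∧ z₀ ≤ z.re) →
      f z = g z - h z * (1 - z / z₀) ^ (1 / 2 : ℂ)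

end PlaneTree

/-!
Why the theorem is true. Splitting off the first branch `T` of a tree, with rest `T'`, gives
`σ₁ = σ₂(T) σ₁(T')`, `σ₂ = σ(T) σ₂(T')`, `Z₂ = Z(T) Z₂(T')` and `Z = Z(T) Z(T') + Z₂(T) Z₂(T')`,
where `σ₁ = σ - σ₂` counts the independent sets that contain the root. This is
`PlaneTree.isRootJoin`, with the counting lemmas for `IsRootJoin`. So the generating functions `P`,
`Q`, `R`, `S`, `U`, `Y` of the weights `σ Z`, `σ Z₂`, `σ₂ Z`, `σ₂ Z₂`, `σ₁ Z₂`, `σ₁ Z` satisfy a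
quadratic system, from which `PlaneTree.polynomial_of_system` eliminates all unknowns but `S`.

The curve cut out by the system is rational. With `m = z / ((1 - P) (1 - R))` one finds
`z = m / φ(m)`, `φ(m) = (1 + m²)² (1 + m + m²)³`, `S = m / ((1 + m²) (1 + m + m²))` and
`P = 1 - 1 / ((1 + m²) (1 + m + m²)²)` (`PlaneTree.param_spec`). The function `m / φ(m)` has its first
positive critical point at the root `critPt ≈ 0.2326` of `9 t⁴ + 6 t³ + 8 t² + 2 t = 1`, and
`z₀ = critPt / φ(critPt)`. At `z₀` the parametrized solution bounds all partial sums, by induction on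
the size of the trees; hence all series converge absolutely on the closed disc `|z| ≤ z₀`.

The analytic continuation is obtained in the variable `s = √(1 - z / z₀)`. A branch of
`√(1 - (m / φ(m)) / z₀)` is holomorphic near `|m| ≤ critPt` and has a simple zero at `critPt`
(`PlaneTree.rootFun`). It is injective with nonvanishing derivative on the compact set of values of
`m` on the closed disc, hence invertible near that set (`exists_analytic_inverse`): so `m`, and with
it `S` and `P`, is a holomorphic function of `s` on an open set containing all `√(1 - z / z₀)` with
`|z| ≤ z₀` (`PlaneTree.exists_param_of_sqrt`). By compactness this set contains the image of a larger
slit disc, and the even and odd parts in `s` are the functions `g` and `-h`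
(`hasDominantSqrtSingularity_of_sqrt`).

For the expectation, let `P = F(s)` and `F'(0) = -B`. The numbers of plane trees are the Catalan
numbers, with generating function `(1 - √(1 - 4 z)) / 2`, so subtracting `2 B` times this function,
taken at `z / (4 z₀)`, from `P` leaves, up to a constant, `F(s) - F'(0) s`. The second derivative of
this difference with respect to `z` is `O(|s| ^ (-1))`, which is integrable on the circles
`|z| = ρ < z₀`, uniformly in `ρ`, so the coefficients of the difference are `O(n ^ (-2) z₀ ^ (-n))`
(`exists_coeff_bound_of_sqrt`). As the number of trees is at least of the order
`n ^ (-3 / 2) 4 ^ n`, the quotient of coefficients is asymptotic to `2 B (1 / (4 z₀)) ^ n`.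
-/

/-! ### Two rooted graphs joined by an edge between their roots -/

/-- `G` consists of copies of `G₁` and `G₂`, embedded by `i₁` and `i₂`, together with one further
edge, which joins the two roots `r₁` and `r₂`. -/
structure IsRootJoin {V₁ V₂ V : Type} (G₁ : SimpleGraph V₁) (r₁ : V₁) (G₂ : SimpleGraph V₂)
    (r₂ : V₂) (G : SimpleGraph V) (i₁ : V₁ → V) (i₂ : V₂ → V) : Prop where
  inj₁ : Function.Injective i₁
  inj₂ : Function.Injective i₂
  disj : ∀ u v, i₁ u ≠ i₂ v
  cover : ∀ x, (∃ u, i₁ u = x) ∨ ∃ v, i₂ v = x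
  adj₁ : ∀ u v, G.Adj (i₁ u) (i₁ v) ↔ G₁.Adj u v
  adj₂ : ∀ u v, G.Adj (i₂ u) (i₂ v) ↔ G₂.Adj u v
  adj₁₂ : ∀ u v, G.Adj (i₁ u) (i₂ v) ↔ u = r₁ ∧ v = r₂

/-- A set of edges of `G`, no two of which share a vertex. -/
def SimpleGraph.IsIndepEdges {V : Type} (G : SimpleGraph V) (M : Set (Sym2 V)) : Prop :=
  M ⊆ G.edgeSet ∧ M.Pairwise fun e f => ∀ v, v ∈ e → v ∉ f

namespace IsRootJoin

variable {V₁ V₂ V : Type} {G₁ : SimpleGraph V₁} {r₁ : V₁} {G₂ : SimpleGraph V₂} {r₂ : V₂}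
  {G : SimpleGraph V} {i₁ : V₁ → V} {i₂ : V₂ → V}

/-- A vertex set of the join is a pair of vertex sets of the two parts. -/
def setEquiv (h : IsRootJoin G₁ r₁ G₂ r₂ G i₁ i₂) : Set V ≃ Set V₁ × Set V₂ where
  toFun s := (i₁ ⁻¹' s, i₂ ⁻¹' s)
  invFun p := i₁ '' p.1 ∪ i₂ '' p.2
  left_inv s := by
    ext x
    rcases h.cover x with ⟨u, rfl⟩ | ⟨u, rfl⟩ <;>
      simp [h.inj₁.eq_iff, h.inj₂.eq_iff, h.disj, fun a b => (h.disj a b).symm]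
  right_inv p := by
    ext x <;> simp [h.inj₁.eq_iff, h.inj₂.eq_iff, h.disj, fun a b => (h.disj a b).symm]

theorem isIndepSet_iff (h : IsRootJoin G₁ r₁ G₂ r₂ G i₁ i₂) (s : Set V) :
    G.IsIndepSet s ↔ G₁.IsIndepSet (i₁ ⁻¹' s) ∧ G₂.IsIndepSet (i₂ ⁻¹' s) ∧
      ¬ (i₁ r₁ ∈ s ∧ i₂ r₂ ∈ s) := by
  constructor
  · intro hs
    refine ⟨fun a ha b hb hab => ?_, fun a ha b hb hab => ?_, fun ⟨ha, hb⟩ => ?_⟩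
    · change ¬ G₁.Adj a b
      rw [← h.adj₁]
      exact hs ha hb (h.inj₁.ne hab)
    · change ¬ G₂.Adj a b
      rw [← h.adj₂]
      exact hs ha hb (h.inj₂.ne hab)
    · exact hs ha hb (h.disj _ _) ((h.adj₁₂ _ _).2 ⟨rfl, rfl⟩)
  · rintro ⟨h1, h2, h3⟩ x hx y hy hxy
    rcases h.cover x with ⟨u, rfl⟩ | ⟨u, rfl⟩ <;> rcases h.cover y with ⟨v, rfl⟩ | ⟨v, rfl⟩
    · rw [h.adj₁]
      exact h1 hx hy (fun e => hxy (by rw [e]))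
    · rw [h.adj₁₂]
      rintro ⟨rfl, rfl⟩
      exact h3 ⟨hx, hy⟩
    · rw [G.adj_comm, h.adj₁₂]
      rintro ⟨rfl, rfl⟩
      exact h3 ⟨hy, hx⟩
    · rw [h.adj₂]
      exact h2 hx hy (fun e => hxy (by rw [e]))

theorem card_indepSet_notMem (h : IsRootJoin G₁ r₁ G₂ r₂ G i₁ i₂) :
    Nat.card {s : Set V // G.IsIndepSet s ∧ i₂ r₂ ∉ s} =
      Nat.card {s // G₁.IsIndepSet s} * Nat.card {s // G₂.IsIndepSet s ∧ r₂ ∉ s} := by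
  rw [← Nat.card_prod]
  refine Nat.card_congr (Equiv.trans (h.setEquiv.subtypeEquiv fun s => ?_)
    (Equiv.subtypeProdEquivProd (p := fun s => G₁.IsIndepSet s)
      (q := fun s => G₂.IsIndepSet s ∧ r₂ ∉ s)))
  rw [h.isIndepSet_iff]
  simp only [setEquiv, Equiv.coe_fn_mk, Set.mem_preimage]
  tauto

theorem card_indepSet_mem (h : IsRootJoin G₁ r₁ G₂ r₂ G i₁ i₂) :
    Nat.card {s : Set V // G.IsIndepSet s ∧ i₂ r₂ ∈ s} =
      Nat.card {s // G₁.IsIndepSet s ∧ r₁ ∉ s} * Nat.card {s // G₂.IsIndepSet s ∧ r₂ ∈ s} := by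
  rw [← Nat.card_prod]
  refine Nat.card_congr (Equiv.trans (h.setEquiv.subtypeEquiv fun s => ?_)
    (Equiv.subtypeProdEquivProd (p := fun s => G₁.IsIndepSet s ∧ r₁ ∉ s)
      (q := fun s => G₂.IsIndepSet s ∧ r₂ ∈ s)))
  rw [h.isIndepSet_iff]
  simp only [setEquiv, Equiv.coe_fn_mk, Set.mem_preimage]
  tauto

/-- The union of the copies of an edge set of the first part and one of the second. -/
def edgeUnion (i₁ : V₁ → V) (i₂ : V₂ → V) (p : Set (Sym2 V₁) × Set (Sym2 V₂)) : Set (Sym2 V) :=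
  Sym2.map i₁ '' p.1 ∪ Sym2.map i₂ '' p.2

theorem map_ne_map (h : IsRootJoin G₁ r₁ G₂ r₂ G i₁ i₂) (e : Sym2 V₁) (f : Sym2 V₂) :
    Sym2.map i₁ e ≠ Sym2.map i₂ f := by
  induction e with | _ a b
  induction f with | _ c d
  simp [h.disj]

theorem bridge_ne_map₁ (h : IsRootJoin G₁ r₁ G₂ r₂ G i₁ i₂) (e : Sym2 V₁) :
    s(i₁ r₁, i₂ r₂) ≠ Sym2.map i₁ e := by
  induction e with | _ a b
  simp [fun a b => (h.disj a b).symm]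

theorem bridge_ne_map₂ (h : IsRootJoin G₁ r₁ G₂ r₂ G i₁ i₂) (e : Sym2 V₂) :
    s(i₁ r₁, i₂ r₂) ≠ Sym2.map i₂ e := by
  induction e with | _ a b
  simp [h.disj]

theorem preimage_edgeUnion₁ (h : IsRootJoin G₁ r₁ G₂ r₂ G i₁ i₂)
    (p : Set (Sym2 V₁) × Set (Sym2 V₂)) : Sym2.map i₁ ⁻¹' edgeUnion i₁ i₂ p = p.1 := by
  ext x
  simp [edgeUnion, (Sym2.map.injective h.inj₁).eq_iff, fun a b => (h.map_ne_map a b).symm]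

theorem preimage_edgeUnion₂ (h : IsRootJoin G₁ r₁ G₂ r₂ G i₁ i₂)
    (p : Set (Sym2 V₁) × Set (Sym2 V₂)) : Sym2.map i₂ ⁻¹' edgeUnion i₁ i₂ p = p.2 := by
  ext x
  simp [edgeUnion, (Sym2.map.injective h.inj₂).eq_iff, h.map_ne_map]

theorem edgeUnion_injective (h : IsRootJoin G₁ r₁ G₂ r₂ G i₁ i₂) :
    Function.Injective (edgeUnion i₁ i₂) := fun p q hpq =>
  Prod.ext (by rw [← h.preimage_edgeUnion₁ p, hpq, h.preimage_edgeUnion₁])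
    (by rw [← h.preimage_edgeUnion₂ p, hpq, h.preimage_edgeUnion₂])

theorem bridge_notMem_edgeUnion (h : IsRootJoin G₁ r₁ G₂ r₂ G i₁ i₂)
    (p : Set (Sym2 V₁) × Set (Sym2 V₂)) : s(i₁ r₁, i₂ r₂) ∉ edgeUnion i₁ i₂ p := by
  rintro (⟨e, -, he⟩ | ⟨e, -, he⟩)
  · exact h.bridge_ne_map₁ e he.symm
  · exact h.bridge_ne_map₂ e he.symm

theorem mem_edgeSet_iff (h : IsRootJoin G₁ r₁ G₂ r₂ G i₁ i₂) (e : Sym2 V) :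
    e ∈ G.edgeSet ↔ (∃ f ∈ G₁.edgeSet, Sym2.map i₁ f = e) ∨ (∃ f ∈ G₂.edgeSet, Sym2.map i₂ f = e) ∨
      e = s(i₁ r₁, i₂ r₂) := by
  constructor
  · induction e with | _ x y
    intro he
    rw [SimpleGraph.mem_edgeSet] at he
    rcases h.cover x with ⟨u, rfl⟩ | ⟨u, rfl⟩ <;> rcases h.cover y with ⟨v, rfl⟩ | ⟨v, rfl⟩
    · exact Or.inl ⟨s(u, v), (h.adj₁ u v).1 he, rfl⟩
    · obtain ⟨rfl, rfl⟩ := (h.adj₁₂ _ _).1 he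
      exact Or.inr (Or.inr rfl)
    · obtain ⟨rfl, rfl⟩ := (h.adj₁₂ _ _).1 he.symm
      exact Or.inr (Or.inr Sym2.eq_swap)
    · exact Or.inr (Or.inl ⟨s(u, v), (h.adj₂ u v).1 he, rfl⟩)
  · rintro (⟨f, hf, rfl⟩ | ⟨f, hf, rfl⟩ | rfl)
    · induction f with | _ x y
      exact (h.adj₁ x y).2 hf
    · induction f with | _ x y
      exact (h.adj₂ x y).2 hf
    · exact (h.adj₁₂ _ _).2 ⟨rfl, rfl⟩

theorem edgeUnion_preimage (h : IsRootJoin G₁ r₁ G₂ r₂ G i₁ i₂) {M : Set (Sym2 V)}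
    (hM : M ⊆ G.edgeSet) :
    edgeUnion i₁ i₂ (Sym2.map i₁ ⁻¹' M, Sym2.map i₂ ⁻¹' M) = M \ {s(i₁ r₁, i₂ r₂)} := by
  ext e
  constructor
  · intro he
    refine ⟨?_, fun h' => h.bridge_notMem_edgeUnion _ (h' ▸ he)⟩
    rcases he with ⟨f, hf, rfl⟩ | ⟨f, hf, rfl⟩ <;> exact hf
  · rintro ⟨he, he'⟩
    rcases (h.mem_edgeSet_iff e).1 (hM he) with ⟨f, -, rfl⟩ | ⟨f, -, rfl⟩ | rfl
    · exact Or.inl ⟨f, he, rfl⟩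
    · exact Or.inr ⟨f, he, rfl⟩
    · exact absurd rfl he'

theorem isIndepEdges_edgeUnion_iff (h : IsRootJoin G₁ r₁ G₂ r₂ G i₁ i₂)
    (p : Set (Sym2 V₁) × Set (Sym2 V₂)) :
    G.IsIndepEdges (edgeUnion i₁ i₂ p) ↔ G₁.IsIndepEdges p.1 ∧ G₂.IsIndepEdges p.2 := by
  have hinj₁ := Sym2.map.injective h.inj₁
  have hinj₂ := Sym2.map.injective h.inj₂
  constructor
  · rintro ⟨hE, hP⟩
    refine ⟨⟨fun e he => ?_, fun e he f hf hef v hv hv' => ?_⟩,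
      ⟨fun e he => ?_, fun e he f hf hef v hv hv' => ?_⟩⟩
    · rcases (h.mem_edgeSet_iff _).1 (hE (Or.inl ⟨e, he, rfl⟩)) with ⟨f, hf, hfe⟩ | ⟨f, -, hfe⟩ | hfe
      · exact hinj₁ hfe ▸ hf
      · exact absurd hfe.symm (h.map_ne_map _ _)
      · exact absurd hfe.symm (h.bridge_ne_map₁ _)
    · exact hP (Or.inl ⟨e, he, rfl⟩) (Or.inl ⟨f, hf, rfl⟩) (hinj₁.ne hef) (i₁ v)
        (Sym2.mem_map.2 ⟨v, hv, rfl⟩) (Sym2.mem_map.2 ⟨v, hv', rfl⟩)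
    · rcases (h.mem_edgeSet_iff _).1 (hE (Or.inr ⟨e, he, rfl⟩)) with ⟨f, -, hfe⟩ | ⟨f, hf, hfe⟩ | hfe
      · exact absurd hfe (h.map_ne_map _ _)
      · exact hinj₂ hfe ▸ hf
      · exact absurd hfe.symm (h.bridge_ne_map₂ _)
    · exact hP (Or.inr ⟨e, he, rfl⟩) (Or.inr ⟨f, hf, rfl⟩) (hinj₂.ne hef) (i₂ v)
        (Sym2.mem_map.2 ⟨v, hv, rfl⟩) (Sym2.mem_map.2 ⟨v, hv', rfl⟩)
  · rintro ⟨⟨hE₁, hP₁⟩, ⟨hE₂, hP₂⟩⟩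
    refine ⟨?_, ?_⟩
    · rintro _ (⟨f, hf, rfl⟩ | ⟨f, hf, rfl⟩)
      · exact (h.mem_edgeSet_iff _).2 (Or.inl ⟨f, hE₁ hf, rfl⟩)
      · exact (h.mem_edgeSet_iff _).2 (Or.inr (Or.inl ⟨f, hE₂ hf, rfl⟩))
    · rintro _ (⟨e, he, rfl⟩ | ⟨e, he, rfl⟩) _ (⟨f, hf, rfl⟩ | ⟨f, hf, rfl⟩) hef v hv hv'
        <;> obtain ⟨a, ha, rfl⟩ := Sym2.mem_map.1 hv <;> obtain ⟨b, hb, hab⟩ := Sym2.mem_map.1 hv'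
      · exact hP₁ he hf (fun h' => hef (by rw [h'])) a ha (h.inj₁ hab ▸ hb)
      · exact h.disj _ _ hab.symm
      · exact h.disj _ _ hab
      · exact hP₂ he hf (fun h' => hef (by rw [h'])) a ha (h.inj₂ hab ▸ hb)

theorem isIndepEdges_insert_iff (h : IsRootJoin G₁ r₁ G₂ r₂ G i₁ i₂)
    (p : Set (Sym2 V₁) × Set (Sym2 V₂)) :
    G.IsIndepEdges (insert s(i₁ r₁, i₂ r₂) (edgeUnion i₁ i₂ p)) ↔
      (G₁.IsIndepEdges p.1 ∧ ∀ e ∈ p.1, r₁ ∉ e) ∧ (G₂.IsIndepEdges p.2 ∧ ∀ e ∈ p.2, r₂ ∉ e) := by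
  have hb := h.bridge_notMem_edgeUnion p
  have hsymm : Std.Symm fun e f : Sym2 V => ∀ v, v ∈ e → v ∉ f :=
    ⟨fun e f hef v hv hv' => hef v hv' hv⟩
  have hbE : s(i₁ r₁, i₂ r₂) ∈ G.edgeSet := (h.mem_edgeSet_iff _).2 (Or.inr (Or.inr rfl))
  have key := h.isIndepEdges_edgeUnion_iff p
  have hbridge : (∀ e ∈ edgeUnion i₁ i₂ p, ∀ v, v ∈ s(i₁ r₁, i₂ r₂) → v ∉ e) ↔
      (∀ e ∈ p.1, r₁ ∉ e) ∧ (∀ e ∈ p.2, r₂ ∉ e) := by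
    constructor
    · intro H
      exact ⟨fun e he hr => H _ (Or.inl ⟨e, he, rfl⟩) (i₁ r₁) (Sym2.mem_mk_left _ _)
          (Sym2.mem_map.2 ⟨_, hr, rfl⟩),
        fun e he hr => H _ (Or.inr ⟨e, he, rfl⟩) (i₂ r₂) (Sym2.mem_mk_right _ _)
          (Sym2.mem_map.2 ⟨_, hr, rfl⟩)⟩
    · rintro ⟨H₁, H₂⟩ _ (⟨e, he, rfl⟩ | ⟨e, he, rfl⟩) v hv hv' <;>
        obtain ⟨a, ha, rfl⟩ := Sym2.mem_map.1 hv' <;> rcases Sym2.mem_iff.1 hv with hv | hv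
      · exact H₁ e he (h.inj₁ hv ▸ ha)
      · exact h.disj _ _ hv
      · exact h.disj _ _ hv.symm
      · exact H₂ e he (h.inj₂ hv ▸ ha)
  unfold SimpleGraph.IsIndepEdges at key ⊢
  rw [Set.insert_subset_iff, Set.pairwise_insert_of_symm_of_notMem hb, hbridge]
  tauto

theorem card_indepEdges_avoiding (h : IsRootJoin G₁ r₁ G₂ r₂ G i₁ i₂) :
    Nat.card {M : Set (Sym2 V) // G.IsIndepEdges M ∧ ∀ e ∈ M, i₂ r₂ ∉ e} =
      Nat.card {M // G₁.IsIndepEdges M} *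
        Nat.card {M // G₂.IsIndepEdges M ∧ ∀ e ∈ M, r₂ ∉ e} := by
  rw [← Nat.card_prod]
  have hmem : ∀ p : Set (Sym2 V₁) × Set (Sym2 V₂),
      (∀ e ∈ edgeUnion i₁ i₂ p, i₂ r₂ ∉ e) ↔ ∀ e ∈ p.2, r₂ ∉ e := by
    intro p
    constructor
    · exact fun H e he hr => H _ (Or.inr ⟨e, he, rfl⟩) (Sym2.mem_map.2 ⟨_, hr, rfl⟩)
    · rintro H _ (⟨e, he, rfl⟩ | ⟨e, he, rfl⟩) hv <;> obtain ⟨a, ha, hav⟩ := Sym2.mem_map.1 hv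
      · exact h.disj _ _ hav
      · exact H e he (h.inj₂ hav ▸ ha)
  refine (Nat.card_congr (Equiv.ofBijective (fun q => ⟨edgeUnion i₁ i₂ (q.1.1, q.2.1),
    (h.isIndepEdges_edgeUnion_iff _).2 ⟨q.1.2, q.2.2.1⟩, (hmem _).2 q.2.2.2⟩) ⟨?_, ?_⟩)).symm
  · intro q q' hq
    have := h.edgeUnion_injective (Subtype.ext_iff.1 hq)
    simp only [Prod.mk.injEq] at this
    exact Prod.ext (Subtype.ext this.1) (Subtype.ext this.2)
  · rintro ⟨M, hM, hM'⟩
    have hu : edgeUnion i₁ i₂ (Sym2.map i₁ ⁻¹' M, Sym2.map i₂ ⁻¹' M) = M := by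
      rw [h.edgeUnion_preimage hM.1, Set.sdiff_singleton_eq_self]
      exact fun hb => hM' _ hb (Sym2.mem_mk_right _ _)
    have h1 := (h.isIndepEdges_edgeUnion_iff _).1 (hu.symm ▸ hM)
    have h2 := (hmem _).1 (hu.symm ▸ hM')
    exact ⟨(⟨_, h1.1⟩, ⟨_, h1.2, h2⟩), Subtype.ext hu⟩

theorem card_indepEdges_without_bridge (h : IsRootJoin G₁ r₁ G₂ r₂ G i₁ i₂) :
    Nat.card {M : Set (Sym2 V) // G.IsIndepEdges M ∧ s(i₁ r₁, i₂ r₂) ∉ M} =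
      Nat.card {M // G₁.IsIndepEdges M} * Nat.card {M // G₂.IsIndepEdges M} := by
  rw [← Nat.card_prod]
  refine (Nat.card_congr (Equiv.ofBijective (fun q => ⟨edgeUnion i₁ i₂ (q.1.1, q.2.1),
    (h.isIndepEdges_edgeUnion_iff _).2 ⟨q.1.2, q.2.2⟩, h.bridge_notMem_edgeUnion _⟩)
    ⟨?_, ?_⟩)).symm
  · intro q q' hq
    have := h.edgeUnion_injective (Subtype.ext_iff.1 hq)
    simp only [Prod.mk.injEq] at this
    exact Prod.ext (Subtype.ext this.1) (Subtype.ext this.2)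
  · rintro ⟨M, hM, hM'⟩
    have hu : edgeUnion i₁ i₂ (Sym2.map i₁ ⁻¹' M, Sym2.map i₂ ⁻¹' M) = M := by
      rw [h.edgeUnion_preimage hM.1, Set.sdiff_singleton_eq_self hM']
    have h1 := (h.isIndepEdges_edgeUnion_iff _).1 (hu.symm ▸ hM)
    exact ⟨(⟨_, h1.1⟩, ⟨_, h1.2⟩), Subtype.ext hu⟩

theorem card_indepEdges_with_bridge (h : IsRootJoin G₁ r₁ G₂ r₂ G i₁ i₂) :
    Nat.card {M : Set (Sym2 V) // G.IsIndepEdges M ∧ s(i₁ r₁, i₂ r₂) ∈ M} =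
      Nat.card {M // G₁.IsIndepEdges M ∧ ∀ e ∈ M, r₁ ∉ e} *
        Nat.card {M // G₂.IsIndepEdges M ∧ ∀ e ∈ M, r₂ ∉ e} := by
  rw [← Nat.card_prod]
  refine (Nat.card_congr (Equiv.ofBijective
    (fun q => ⟨insert s(i₁ r₁, i₂ r₂) (edgeUnion i₁ i₂ (q.1.1, q.2.1)),
      (h.isIndepEdges_insert_iff _).2 ⟨q.1.2, q.2.2⟩, Set.mem_insert _ _⟩) ⟨?_, ?_⟩)).symm
  · intro q q' hq
    have h0 := congrArg (· \ {s(i₁ r₁, i₂ r₂)}) (Subtype.ext_iff.1 hq)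
    simp only [Set.insert_sdiff_of_mem _ (Set.mem_singleton _),
      Set.sdiff_singleton_eq_self (h.bridge_notMem_edgeUnion _)] at h0
    have := h.edgeUnion_injective h0
    simp only [Prod.mk.injEq] at this
    exact Prod.ext (Subtype.ext this.1) (Subtype.ext this.2)
  · rintro ⟨M, hM, hM'⟩
    have hu : insert s(i₁ r₁, i₂ r₂)
        (edgeUnion i₁ i₂ (Sym2.map i₁ ⁻¹' M, Sym2.map i₂ ⁻¹' M)) = M := by
      rw [h.edgeUnion_preimage hM.1, Set.insert_sdiff_singleton, Set.insert_eq_of_mem hM']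
    have h1 := (h.isIndepEdges_insert_iff _).1 (hu.symm ▸ hM)
    exact ⟨(⟨_, h1.1⟩, ⟨_, h1.2⟩), Subtype.ext hu⟩

end IsRootJoin

/-- Counting the elements of a type with a property according to a second property. -/
theorem Nat.card_subtype_eq_add {α : Type*} [Finite α] (p q : α → Prop) :
    Nat.card {a // p a} = Nat.card {a // p a ∧ q a} + Nat.card {a // p a ∧ ¬ q a} := by
  classical
  rw [← Nat.card_sum]
  exact Nat.card_congr ((Equiv.sumCompl (fun a : {a // p a} => q a)).symm.trans
    (Equiv.sumCongr (Equiv.subtypeSubtypeEquivSubtypeInter p q)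
      (Equiv.subtypeSubtypeEquivSubtypeInter p fun a => ¬ q a)))

/-! ### Splitting off the first branch of a plane tree -/

namespace PlaneTree

/-- The vertices of the first branch, as vertices of the tree. -/
def inFirst (T : PlaneTree) (cs : List PlaneTree) (v : Vertex T) : Vertex (node (T :: cs)) :=
  Vertex.inBranch (cs := T :: cs) ⟨0, Nat.succ_pos _⟩ v

/-- The vertices outside the first branch form a plane tree with the same root. -/
def inRest (T : PlaneTree) (cs : List PlaneTree) : Vertex (node cs) → Vertex (node (T :: cs))
  | Vertex.root _ => Vertex.root _
  | Vertex.inBranch i v => Vertex.inBranch (cs := T :: cs) i.succ v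

theorem inBranch_inj {cs : List PlaneTree} {i : Fin cs.length} {u v : Vertex (cs.get i)} :
    Vertex.inBranch i u = Vertex.inBranch i v ↔ u = v := by
  constructor
  · intro h
    have := congrArg (vertexEquiv cs) h
    simpa [vertexEquiv] using this
  · rintro rfl
    rfl

theorem index_eq_of_inBranch_eq {cs : List PlaneTree} {i j : Fin cs.length}
    {u : Vertex (cs.get i)} {v : Vertex (cs.get j)}
    (h : Vertex.inBranch i u = Vertex.inBranch j v) : i = j := by
  have := congrArg (vertexEquiv cs) h
  simp only [vertexEquiv, Equiv.coe_fn_mk, Option.some.injEq, Sigma.mk.injEq] at this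
  exact this.1

theorem isParent_iff {cs : List PlaneTree} {x y : Vertex (node cs)} :
    IsParent x y ↔
      (∃ i, x = Vertex.root cs ∧ y = Vertex.inBranch i (rootOf (cs.get i))) ∨
      ∃ i u v, IsParent u v ∧ x = Vertex.inBranch i u ∧ y = Vertex.inBranch i v := by
  constructor
  · intro h
    cases h with
    | root i => exact Or.inl ⟨i, rfl, rfl⟩
    | inBranch i h => exact Or.inr ⟨i, _, _, h, rfl, rfl⟩
  · rintro (⟨i, rfl, rfl⟩ | ⟨i, u, v, h, rfl, rfl⟩)
    · exact IsParent.root i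
    · exact IsParent.inBranch i h

theorem isParent_inBranch {cs : List PlaneTree} {i : Fin cs.length} {u v : Vertex (cs.get i)} :
    IsParent (Vertex.inBranch i u) (Vertex.inBranch i v) ↔ IsParent u v := by
  refine ⟨fun h => ?_, IsParent.inBranch i⟩
  rcases isParent_iff.1 h with ⟨j, h, -⟩ | ⟨j, u', v', h, hu, hv⟩
  · cases h
  · obtain rfl := index_eq_of_inBranch_eq hu
    rw [inBranch_inj] at hu hv
    rwa [hu, hv]

theorem isParent_root {cs : List PlaneTree} {i : Fin cs.length} {v : Vertex (cs.get i)} :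
    IsParent (Vertex.root cs) (Vertex.inBranch i v) ↔ v = rootOf (cs.get i) := by
  refine ⟨fun h => ?_, fun h => h ▸ IsParent.root i⟩
  rcases isParent_iff.1 h with ⟨j, -, hv⟩ | ⟨j, u', v', h, hu, hv⟩
  · obtain rfl := index_eq_of_inBranch_eq hv
    rwa [inBranch_inj] at hv
  · cases hu

theorem not_isParent_root {cs : List PlaneTree} {x : Vertex (node cs)} :
    ¬ IsParent x (Vertex.root cs) := by
  intro h
  rcases isParent_iff.1 h with ⟨j, -, hv⟩ | ⟨j, u', v', h, hu, hv⟩ <;> cases hv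

theorem not_isParent_of_index_ne {cs : List PlaneTree} {i j : Fin cs.length}
    {u : Vertex (cs.get i)} {v : Vertex (cs.get j)} (hij : i ≠ j) :
    ¬ IsParent (Vertex.inBranch i u) (Vertex.inBranch j v) := by
  intro h
  rcases isParent_iff.1 h with ⟨k, hu, -⟩ | ⟨k, u', v', h, hu, hv⟩
  · cases hu
  · exact hij ((index_eq_of_inBranch_eq hu).trans (index_eq_of_inBranch_eq hv).symm)

theorem isParent_inRest {T : PlaneTree} {cs : List PlaneTree} {x y : Vertex (node cs)} :
    IsParent (inRest T cs x) (inRest T cs y) ↔ IsParent x y := by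
  cases y with
  | root => exact iff_of_false not_isParent_root not_isParent_root
  | inBranch j v =>
    cases x with
    | root => exact isParent_root.trans isParent_root.symm
    | inBranch i u =>
      by_cases hij : i = j
      · subst hij
        exact isParent_inBranch.trans isParent_inBranch.symm
      · exact iff_of_false (not_isParent_of_index_ne (by simpa using hij))
          (not_isParent_of_index_ne hij)

theorem inFirst_injective (T : PlaneTree) (cs : List PlaneTree) :
    Function.Injective (inFirst T cs) := fun _ _ h => inBranch_inj.1 h

theorem inRest_injective (T : PlaneTree) (cs : List PlaneTree) :
    Function.Injective (inRest T cs) := by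
  intro x y h
  cases x with
  | root =>
    cases y with
    | root => rfl
    | inBranch j v => cases h
  | inBranch i u =>
    cases y with
    | root => cases h
    | inBranch j v =>
      have hij : i = j := Fin.succ_injective _ (index_eq_of_inBranch_eq h)
      subst hij
      exact inBranch_inj.2 (inBranch_inj (cs := T :: cs) (i := i.succ).1 h)

theorem isRootJoin (T : PlaneTree) (cs : List PlaneTree) :
    IsRootJoin T.graph (rootOf T) (node cs).graph (rootOf (node cs)) (node (T :: cs)).graph
      (inFirst T cs) (inRest T cs) where
  inj₁ := inFirst_injective T cs
  inj₂ := inRest_injective T cs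
  disj u v h := by
    cases v with
    | root => cases h
    | inBranch j v => exact absurd (index_eq_of_inBranch_eq h) (Fin.succ_ne_zero j).symm
  cover x := by
    cases x with
    | root => exact Or.inr ⟨Vertex.root cs, rfl⟩
    | inBranch i v =>
      refine Fin.cases (motive := fun i => ∀ v : Vertex ((T :: cs).get i),
        (∃ u, inFirst T cs u = Vertex.inBranch (cs := T :: cs) i v) ∨
          ∃ w, inRest T cs w = Vertex.inBranch (cs := T :: cs) i v) ?_ ?_ i v
      · exact fun v => Or.inl ⟨v, rfl⟩
      · exact fun i v => Or.inr ⟨Vertex.inBranch i v, rfl⟩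
  adj₁ u v := by
    simp only [graph, SimpleGraph.fromRel_adj, (inFirst_injective T cs).ne_iff]
    simp only [inFirst, isParent_inBranch]
  adj₂ u v := by
    simp only [graph, SimpleGraph.fromRel_adj, (inRest_injective T cs).ne_iff, isParent_inRest]
  adj₁₂ u v := by
    simp only [graph, SimpleGraph.fromRel_adj]
    cases v with
    | root =>
      have h1 : IsParent (inRest T cs (Vertex.root cs)) (inFirst T cs u) ↔ u = rootOf T :=
        isParent_root (cs := T :: cs)
      have h2 : ¬ IsParent (inFirst T cs u) (inRest T cs (Vertex.root cs)) :=
        not_isParent_root (cs := T :: cs)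
      have h3 : inFirst T cs u ≠ inRest T cs (Vertex.root cs) := fun h => by cases h
      simp [h1, h2, h3, rootOf]
    | inBranch j v =>
      have h0 : (⟨0, Nat.succ_pos _⟩ : Fin (T :: cs).length) ≠ j.succ := (Fin.succ_ne_zero j).symm
      have h1 : ¬ IsParent (inRest T cs (Vertex.inBranch j v)) (inFirst T cs u) :=
        not_isParent_of_index_ne (cs := T :: cs) h0.symm
      have h2 : ¬ IsParent (inFirst T cs u) (inRest T cs (Vertex.inBranch j v)) :=
        not_isParent_of_index_ne (cs := T :: cs) h0
      simp [h1, h2, rootOf]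

/-- The number of independent vertex subsets that contain the root. -/
noncomputable def sigma₁ (T : PlaneTree) : ℕ :=
  Nat.card {s : Set (Vertex T) // T.graph.IsIndepSet s ∧ rootOf T ∈ s}

theorem sigma_eq_add (T : PlaneTree) : T.sigma = T.sigma₁ + T.sigma₂ :=
  Nat.card_subtype_eq_add _ _

theorem size_node_cons (T : PlaneTree) (cs : List PlaneTree) :
    size (node (T :: cs)) = size T + size (node cs) := by
  rw [size_node, size_node]
  change ∑ i : Fin (cs.length + 1), _ + 1 = _
  rw [Fin.sum_univ_succ, add_assoc]
  rfl

theorem sigma₁_node_cons (T : PlaneTree) (cs : List PlaneTree) :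
    sigma₁ (node (T :: cs)) = sigma₂ T * sigma₁ (node cs) :=
  (isRootJoin T cs).card_indepSet_mem

theorem sigma₂_node_cons (T : PlaneTree) (cs : List PlaneTree) :
    sigma₂ (node (T :: cs)) = sigma T * sigma₂ (node cs) :=
  (isRootJoin T cs).card_indepSet_notMem

theorem hosoya₂_node_cons (T : PlaneTree) (cs : List PlaneTree) :
    hosoya₂ (node (T :: cs)) = hosoya T * hosoya₂ (node cs) :=
  (isRootJoin T cs).card_indepEdges_avoiding

theorem hosoya_node_cons (T : PlaneTree) (cs : List PlaneTree) :
    hosoya (node (T :: cs)) = hosoya T * hosoya (node cs) + hosoya₂ T * hosoya₂ (node cs) := by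
  rw [add_comm]
  refine (Nat.card_subtype_eq_add _ _).trans (congrArg₂ (· + ·)
    (isRootJoin T cs).card_indepEdges_with_bridge (isRootJoin T cs).card_indepEdges_without_bridge)

theorem size_node_nil : size (node []) = 1 := by
  rw [size_node]
  rfl

theorem vertex_node_nil (v : Vertex (node [])) : v = rootOf (node []) := by
  cases v with
  | root => rfl
  | inBranch i v => exact i.elim0

instance : Unique (Vertex (node [])) := ⟨⟨rootOf _⟩, vertex_node_nil⟩

theorem sigma₁_node_nil : sigma₁ (node []) = 1 := by
  refine Nat.card_eq_one_iff_unique.2 ⟨⟨fun s t => Subtype.ext ?_⟩,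
    ⟨⟨Set.univ, fun a _ b _ h => absurd (Subsingleton.elim a b) h, Set.mem_univ _⟩⟩⟩
  ext v
  rw [vertex_node_nil v]
  exact iff_of_true s.2.2 t.2.2

theorem sigma₂_node_nil : sigma₂ (node []) = 1 := by
  refine Nat.card_eq_one_iff_unique.2 ⟨⟨fun s t => Subtype.ext ?_⟩,
    ⟨⟨∅, fun a _ b _ h => absurd (Subsingleton.elim a b) h, Set.notMem_empty _⟩⟩⟩
  ext v
  rw [vertex_node_nil v]
  exact iff_of_false s.2.2 t.2.2

theorem not_adj_node_nil (e : Sym2 (Vertex (node []))) : e ∉ (graph (node [])).edgeSet := by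
  induction e with | _ a b
  exact fun h => (SimpleGraph.mem_edgeSet _).1 h |>.ne (Subsingleton.elim a b)

theorem hosoya_node_nil : hosoya (node []) = 1 := by
  refine Nat.card_eq_one_iff_unique.2 ⟨⟨fun s t => Subtype.ext ?_⟩,
    ⟨⟨∅, Set.empty_subset _, Set.pairwise_empty _⟩⟩⟩
  ext e
  exact iff_of_false (fun h => not_adj_node_nil e (s.2.1 h)) fun h => not_adj_node_nil e (t.2.1 h)

theorem hosoya₂_node_nil : hosoya₂ (node []) = 1 := by
  refine Nat.card_eq_one_iff_unique.2 ⟨⟨fun s t => Subtype.ext ?_⟩,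
    ⟨⟨∅, ⟨Set.empty_subset _, Set.pairwise_empty _⟩, fun _ h => h.elim⟩⟩⟩
  ext e
  exact iff_of_false (fun h => not_adj_node_nil e (s.2.1.1 h))
    fun h => not_adj_node_nil e (t.2.1.1 h)

/-- A plane tree is a single vertex, or consists of its first branch and the rest of the tree. -/
def consEquiv : Option (PlaneTree × PlaneTree) ≃ PlaneTree where
  toFun
    | none => node []
    | some (T, node cs) => node (T :: cs)
  invFun
    | node [] => none
    | node (T :: cs) => some (T, node cs)
  left_inv
    | none => rfl
    | some (_, node _) => rfl
  right_inv
    | node [] => rfl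
    | node (_ :: _) => rfl

theorem size_consEquiv (T T' : PlaneTree) : size (consEquiv (some (T, T'))) = size T + size T' := by
  obtain ⟨cs⟩ := T'
  exact size_node_cons T cs

/-! ### The algebraic system of the generating functions -/

theorem mem_treesOfSize {n : ℕ} {T : PlaneTree} : T ∈ treesOfSize n ↔ size T = n := by
  simp [treesOfSize]

theorem size_consEquiv_none : size (consEquiv none) = 1 := size_node_nil

/-- Summation over the trees of a given size by splitting off the first branch. -/
theorem sum_treesOfSize {M : Type*} [AddCommMonoid M] (f : PlaneTree → M) (n : ℕ) :
    ∑ T ∈ treesOfSize n, f T = (if n = 1 then f (node []) else 0) +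
      ∑ p ∈ Finset.HasAntidiagonal.antidiagonal n, ∑ T ∈ treesOfSize p.1, ∑ T' ∈ treesOfSize p.2,
        f (consEquiv (some (T, T'))) := by
  classical
  have hsplit : treesOfSize n = ((if n = 1 then {none} else ∅ : Finset (Option Unit)).image
      fun _ => node []) ∪ ((Finset.HasAntidiagonal.antidiagonal n).sigma fun p =>
        treesOfSize p.1 ×ˢ treesOfSize p.2).image fun q => consEquiv (some q.2) := by
    ext T
    obtain ⟨o, rfl⟩ := consEquiv.surjective T
    rcases o with _ | ⟨T, T'⟩
    · have h0 : ∀ q : PlaneTree × PlaneTree, consEquiv (some q) ≠ consEquiv none :=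
        fun q h => by simpa using consEquiv.injective h
      simp only [mem_treesOfSize, size_consEquiv_none, Finset.mem_union, Finset.mem_image,
        h0, and_false, exists_false, or_false]
      constructor
      · rintro rfl
        exact ⟨none, by simp, rfl⟩
      · rintro ⟨a, ha, -⟩
        by_contra hn
        simp [Ne.symm hn] at ha
    · have h0 : node [] ≠ consEquiv (some (T, T')) :=
        fun h => by simpa using consEquiv.injective (a₁ := none) h
      simp only [mem_treesOfSize, size_consEquiv, Finset.mem_union, Finset.mem_image, h0,
        and_false, exists_false, false_or, Finset.mem_sigma, Finset.HasAntidiagonal.mem_antidiagonal,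
        Finset.mem_product]
      constructor
      · intro h
        exact ⟨⟨(size T, size T'), (T, T')⟩, ⟨h, rfl, rfl⟩, rfl⟩
      · rintro ⟨⟨⟨a, b⟩, c, d⟩, ⟨h, hc, hd⟩, he⟩
        have := consEquiv.injective he
        simp only [Option.some.injEq, Prod.mk.injEq] at this
        rw [← this.1, ← this.2]
        simp only at hc hd h
        omega
  have hinj : Set.InjOn (fun q : (_ : ℕ × ℕ) × PlaneTree × PlaneTree => consEquiv (some q.2))
      ((Finset.HasAntidiagonal.antidiagonal n).sigma fun p =>
        treesOfSize p.1 ×ˢ treesOfSize p.2) := by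
    rintro ⟨⟨a, b⟩, c, d⟩ hq ⟨⟨a', b'⟩, c', d'⟩ hq' h
    have := consEquiv.injective h
    simp only [Option.some.injEq, Prod.mk.injEq] at this
    simp only [Finset.coe_sigma, Set.mem_sigma_iff, Finset.mem_coe, Finset.mem_product,
      mem_treesOfSize] at hq hq'
    obtain ⟨rfl, rfl⟩ := this
    obtain ⟨-, h1, h2⟩ := hq
    obtain ⟨-, h3, h4⟩ := hq'
    subst h1 h2 h3 h4
    rfl
  rw [hsplit, Finset.sum_union, Finset.sum_image (by split_ifs <;> simp), Finset.sum_image hinj,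
    Finset.sum_sigma]
  · refine congrArg₂ _ (by split_ifs <;> simp) (Finset.sum_congr rfl fun p _ => ?_)
    rw [Finset.sum_product]
  · rw [Finset.disjoint_left]
    intro T h1 h2
    obtain ⟨_, -, rfl⟩ := Finset.mem_image.1 h1
    obtain ⟨q, -, h⟩ := Finset.mem_image.1 h2
    simpa using consEquiv.injective (a₂ := none) h

theorem genFun_add (v w : PlaneTree → ℕ) :
    genFun (fun T => v T + w T) = genFun v + genFun w := by
  ext n
  simp [genFun, Finset.sum_add_distrib]

/-- If a weight is multiplicative in the first branch and the rest of the tree, its generating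
function is a product, up to the term `X` of the one-vertex tree. -/
theorem genFun_eq_of_mul {f a b : PlaneTree → ℕ} (h0 : f (node []) = 1)
    (h : ∀ T T', f (consEquiv (some (T, T'))) = a T * b T') :
    genFun f = PowerSeries.X + genFun a * genFun b := by
  ext n
  rw [map_add, PowerSeries.coeff_mul, PowerSeries.coeff_X]
  simp only [genFun, PowerSeries.coeff_mk, sum_treesOfSize (fun T => (f T : ℤ)) n, h0, h]
  simp [Finset.sum_mul_sum]

/-- The same for a sum of two multiplicative terms. This occurs for weights with the factor `Z`, as a
matching may or may not contain the edge between the root and its first child. -/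
theorem genFun_eq_of_mul_add_mul {f a b c d : PlaneTree → ℕ} (h0 : f (node []) = 1)
    (h : ∀ T T', f (consEquiv (some (T, T'))) = a T * b T' + c T * d T') :
    genFun f = PowerSeries.X + genFun a * genFun b + genFun c * genFun d := by
  ext n
  rw [map_add, map_add, PowerSeries.coeff_mul, PowerSeries.coeff_mul, PowerSeries.coeff_X]
  simp only [genFun, PowerSeries.coeff_mk, sum_treesOfSize (fun T => (f T : ℤ)) n, h0, h]
  simp [Finset.sum_mul_sum, Finset.sum_add_distrib, add_assoc]

/-- `σ Z`. -/
noncomputable def wP (T : PlaneTree) : ℕ := T.sigma * T.hosoya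

/-- `σ Z₂`. -/
noncomputable def wQ (T : PlaneTree) : ℕ := T.sigma * T.hosoya₂

/-- `σ₂ Z`. -/
noncomputable def wR (T : PlaneTree) : ℕ := T.sigma₂ * T.hosoya

/-- `σ₂ Z₂`. -/
noncomputable def wS (T : PlaneTree) : ℕ := T.sigma₂ * T.hosoya₂

/-- `σ₁ Z₂`. -/
noncomputable def wU (T : PlaneTree) : ℕ := T.sigma₁ * T.hosoya₂

/-- `σ₁ Z`. -/
noncomputable def wY (T : PlaneTree) : ℕ := T.sigma₁ * T.hosoya

theorem wP_eq (T : PlaneTree) : wP T = wR T + wY T := by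
  rw [wP, wR, wY, sigma_eq_add]
  ring

theorem wQ_eq (T : PlaneTree) : wQ T = wS T + wU T := by
  rw [wQ, wS, wU, sigma_eq_add]
  ring

theorem wR_nil : wR (node []) = 1 := by simp [wR, sigma₂_node_nil, hosoya_node_nil]
theorem wS_nil : wS (node []) = 1 := by simp [wS, sigma₂_node_nil, hosoya₂_node_nil]
theorem wU_nil : wU (node []) = 1 := by simp [wU, sigma₁_node_nil, hosoya₂_node_nil]
theorem wY_nil : wY (node []) = 1 := by simp [wY, sigma₁_node_nil, hosoya_node_nil]

theorem wR_cons (T T' : PlaneTree) :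
    wR (consEquiv (some (T, T'))) = wP T * wR T' + wQ T * wS T' := by
  obtain ⟨cs⟩ := T'
  change sigma₂ (node (T :: cs)) * hosoya (node (T :: cs)) = _
  rw [sigma₂_node_cons, hosoya_node_cons, wP, wR, wQ, wS]
  ring

theorem wS_cons (T T' : PlaneTree) : wS (consEquiv (some (T, T'))) = wP T * wS T' := by
  obtain ⟨cs⟩ := T'
  change sigma₂ (node (T :: cs)) * hosoya₂ (node (T :: cs)) = _
  rw [sigma₂_node_cons, hosoya₂_node_cons, wP, wS]
  ring

theorem wU_cons (T T' : PlaneTree) : wU (consEquiv (some (T, T'))) = wR T * wU T' := by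
  obtain ⟨cs⟩ := T'
  change sigma₁ (node (T :: cs)) * hosoya₂ (node (T :: cs)) = _
  rw [sigma₁_node_cons, hosoya₂_node_cons, wR, wU]
  ring

theorem wY_cons (T T' : PlaneTree) :
    wY (consEquiv (some (T, T'))) = wR T * wY T' + wS T * wU T' := by
  obtain ⟨cs⟩ := T'
  change sigma₁ (node (T :: cs)) * hosoya (node (T :: cs)) = _
  rw [sigma₁_node_cons, hosoya_node_cons, wR, wY, wS, wU]
  ring

/-- Eliminating all unknowns but `S` from the system. The elimination runs through
`z U = z S - z S² - S⁴`, which makes `U` rational in `S` and `z`. -/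
theorem polynomial_of_system {K : Type*} [CommRing K] {z P Q R S U Y : K} (hP : P = R + Y)
    (hQ : Q = S + U) (hR : R = z + P * R + Q * S) (hS : S = z + P * S) (hU : U = z + R * U)
    (hY : Y = z + R * Y + S * U) :
    S ^ 10 + 2 * z * S ^ 8 - 3 * z * S ^ 7 + z ^ 2 * S ^ 6 - 4 * z ^ 2 * S ^ 5
        + 3 * z ^ 2 * S ^ 4 - z ^ 3 * S ^ 3 + 2 * z ^ 3 * S ^ 2 - z ^ 3 * S + z ^ 4 = 0 := by
  have hzR : z * R = z * S + S ^ 3 + U * S ^ 2 := by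
    rw [hQ] at hR
    linear_combination S * hR - R * hS
  have hzY : z * Y = U * (z + S * U) := by linear_combination U * hY - Y * hU
  have h2 : z * U = z ^ 2 + U * (z * S + S ^ 3 + U * S ^ 2) := by
    linear_combination z * hU + U * hzR
  have h1 : z * (S - z) = S * (z * S + S ^ 3 + U * S ^ 2 + z * U + S * U ^ 2) := by
    linear_combination z * hS + S * z * hP + S * hzR + S * hzY
  have h3 : z * U = z * S - z * S ^ 2 - S ^ 4 := by linear_combination h2 - h1
  linear_combination (-z ^ 2) * h2 + (z ^ 2 - z ^ 2 * S - z * S ^ 3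
    - S ^ 2 * (z * U + z * S - z * S ^ 2 - S ^ 4)) * h3

theorem genFun_polynomial {s z : PowerSeries ℤ} (hs : s = genFun (fun T => T.sigma₂ * T.hosoya₂))
    (hz : z = PowerSeries.X) :
    s ^ 10 + 2 * z * s ^ 8 - 3 * z * s ^ 7 + z ^ 2 * s ^ 6 - 4 * z ^ 2 * s ^ 5
        + 3 * z ^ 2 * s ^ 4 - z ^ 3 * s ^ 3 + 2 * z ^ 3 * s ^ 2 - z ^ 3 * s + z ^ 4 = 0 := by
  subst hs hz
  exact polynomial_of_system
    (by rw [show wP = fun T => wR T + wY T from funext wP_eq]; exact genFun_add wR wY)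
    (by rw [show wQ = fun T => wS T + wU T from funext wQ_eq]; exact genFun_add wS wU)
    (genFun_eq_of_mul_add_mul wR_nil wR_cons) (genFun_eq_of_mul wS_nil wS_cons)
    (genFun_eq_of_mul wU_nil wU_cons) (genFun_eq_of_mul_add_mul wY_nil wY_cons)

end PlaneTree

/-! ### Convergence of the generating functions -/

theorem hasSum_option {α E : Type*} [AddCommMonoid E] [TopologicalSpace E] [ContinuousAdd E]
    {g : Option α → E} {e : E} (h : HasSum (fun a => g (some a)) e) : HasSum g (g none + e) := by
  refine HasSum.add_isCompl (Set.isCompl_range_some_none α).symm ?_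
    ((Option.some_injective α).hasSum_range_iff.2 h)
  exact hasSum_unique (β := ({none} : Set (Option α))) _

namespace PlaneTree

/-- The finite set of all plane trees with at most `n` vertices. -/
noncomputable def treesUpTo (n : ℕ) : Finset PlaneTree := (finite_size_le n).toFinset

theorem mem_treesUpTo {n : ℕ} {T : PlaneTree} : T ∈ treesUpTo n ↔ size T ≤ n := by
  simp [treesUpTo]

theorem treesUpTo_zero : treesUpTo 0 = ∅ := by
  ext T
  have := size_pos T
  simp only [mem_treesUpTo, Finset.notMem_empty, iff_false]
  omega

/-- Both parts of a tree with at most `n + 1` vertices have at most `n` vertices. -/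
theorem sum_treesUpTo_succ_le {f : PlaneTree → ℝ} (hf : ∀ T, 0 ≤ f T) (n : ℕ) :
    ∑ T ∈ treesUpTo (n + 1), f T ≤ f (node []) +
      ∑ T ∈ treesUpTo n, ∑ T' ∈ treesUpTo n, f (consEquiv (some (T, T'))) := by
  classical
  have hsub : treesUpTo (n + 1) ⊆
      (Finset.insertNone (treesUpTo n ×ˢ treesUpTo n)).map consEquiv.toEmbedding := by
    intro T hT
    obtain ⟨o, rfl⟩ := consEquiv.surjective T
    refine Finset.mem_map_of_mem _ (Finset.mem_insertNone.2 ?_)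
    rintro ⟨T, T'⟩ rfl
    rw [mem_treesUpTo, size_consEquiv] at hT
    have := size_pos T
    have := size_pos T'
    simp only [Finset.mem_product, mem_treesUpTo]
    omega
  refine (Finset.sum_le_sum_of_subset_of_nonneg hsub fun T _ _ => hf T).trans (le_of_eq ?_)
  rw [Finset.sum_map, Finset.sum_insertNone, Finset.sum_product]
  rfl

/-- The partial sums of `∑ w(T) x ^ |T|`. -/
noncomputable def partialGF (w : PlaneTree → ℕ) (x : ℝ) (n : ℕ) : ℝ :=
  ∑ T ∈ treesUpTo n, (w T : ℝ) * x ^ T.size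

theorem partialGF_nonneg (w : PlaneTree → ℕ) {x : ℝ} (hx : 0 ≤ x) (n : ℕ) :
    0 ≤ partialGF w x n :=
  Finset.sum_nonneg fun _ _ => by positivity

theorem partialGF_add {f v w : PlaneTree → ℕ} (h : ∀ T, f T = v T + w T) (x : ℝ) (n : ℕ) :
    partialGF f x n = partialGF v x n + partialGF w x n := by
  simp only [partialGF, h, Nat.cast_add, add_mul, Finset.sum_add_distrib]

theorem partialGF_succ_le {f a b c d : PlaneTree → ℕ} (h0 : f (node []) = 1)
    (h : ∀ T T', f (consEquiv (some (T, T'))) = a T * b T' + c T * d T') {x : ℝ} (hx : 0 ≤ x)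
    (n : ℕ) : partialGF f x (n + 1) ≤
      x + (partialGF a x n * partialGF b x n + partialGF c x n * partialGF d x n) := by
  refine (sum_treesUpTo_succ_le (fun T => by positivity) n).trans (le_of_eq ?_)
  rw [h0, size_node_nil]
  simp only [h, size_consEquiv, partialGF, Finset.sum_mul_sum, ← Finset.sum_add_distrib]
  refine congrArg₂ _ (by simp) (Finset.sum_congr rfl fun T _ => Finset.sum_congr rfl fun T' _ => ?_)
  push_cast
  ring

/-- A nonnegative solution of the system bounds the partial sums of the generating functions. -/
theorem partialGF_le_of_system {x p q r s u y : ℝ} (hx : 0 ≤ x) (hp : 0 ≤ p) (hq : 0 ≤ q)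
    (hr : 0 ≤ r) (hs : 0 ≤ s) (hP : p = r + y)
    (hQ : q = s + u) (hR : r = x + p * r + q * s) (hS : s = x + p * s) (hU : u = x + r * u)
    (hY : y = x + r * y + s * u) (hu : 0 ≤ u) (hy : 0 ≤ y) (n : ℕ) :
    partialGF wR x n ≤ r ∧ partialGF wS x n ≤ s ∧ partialGF wU x n ≤ u ∧ partialGF wY x n ≤ y := by
  induction n with
  | zero =>
    simp only [partialGF, treesUpTo_zero, Finset.sum_empty]
    exact ⟨hr, hs, hu, hy⟩
  | succ n ih =>
    obtain ⟨iR, iS, iU, iY⟩ := ih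
    have iP : partialGF wP x n ≤ p := by
      rw [partialGF_add wP_eq, hP]
      exact add_le_add iR iY
    have iQ : partialGF wQ x n ≤ q := by
      rw [partialGF_add wQ_eq, hQ]
      exact add_le_add iS iU
    have nn := fun w => partialGF_nonneg w hx n
    refine ⟨?_, ?_, ?_, ?_⟩
    · refine (partialGF_succ_le wR_nil wR_cons hx n).trans ?_
      have h1 := mul_le_mul iP iR (nn _) hp
      have h2 := mul_le_mul iQ iS (nn _) hq
      linarith
    · refine (partialGF_succ_le (c := fun _ => 0) (d := fun _ => 0) wS_nil
        (by simpa using wS_cons) hx n).trans ?_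
      have h1 := mul_le_mul iP iS (nn _) hp
      simp only [partialGF, Nat.cast_zero, zero_mul, Finset.sum_const_zero, mul_zero] at h1 ⊢
      linarith
    · refine (partialGF_succ_le (c := fun _ => 0) (d := fun _ => 0) wU_nil
        (by simpa using wU_cons) hx n).trans ?_
      have h1 := mul_le_mul iR iU (nn _) hr
      simp only [partialGF, Nat.cast_zero, zero_mul, Finset.sum_const_zero, mul_zero] at h1 ⊢
      linarith
    · refine (partialGF_succ_le wY_nil wY_cons hx n).trans ?_
      have h1 := mul_le_mul iR iY (nn _) hr
      have h2 := mul_le_mul iS iU (nn _) hs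
      linarith

theorem summable_of_partialGF_le {w : PlaneTree → ℕ} {x c : ℝ} (hx : 0 ≤ x)
    (h : ∀ n, partialGF w x n ≤ c) :
    Summable (fun T => (w T : ℝ) * x ^ T.size) ∧ ∑' T, (w T : ℝ) * x ^ T.size ≤ c := by
  have hle : ∀ s : Finset PlaneTree, ∑ T ∈ s, (w T : ℝ) * x ^ T.size ≤ c := by
    intro s
    refine le_trans ?_ (h (s.sup size))
    refine Finset.sum_le_sum_of_subset_of_nonneg (fun T hT => ?_) fun T _ _ => by positivity
    exact mem_treesUpTo.2 (Finset.le_sup hT)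
  have hs : Summable (fun T => (w T : ℝ) * x ^ T.size) :=
    summable_of_sum_le (fun T => by positivity) hle
  exact ⟨hs, hs.tsum_le_of_sum_le hle⟩

/-- The sum of the generating function `∑ w(T) z ^ |T|`. -/
noncomputable def gf (w : PlaneTree → ℕ) (z : ℂ) : ℂ := ∑' T : PlaneTree, (w T : ℂ) * z ^ T.size

section Convergent

variable {x : ℝ} {w : PlaneTree → ℕ}

theorem summable_norm_gf (hw : Summable fun T => (w T : ℝ) * x ^ T.size) {z : ℂ} (hz : ‖z‖ ≤ x) :
    Summable fun T => ‖(w T : ℂ) * z ^ T.size‖ := by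
  refine Summable.of_nonneg_of_le (fun _ => norm_nonneg _) (fun T => ?_) hw
  rw [norm_mul, norm_pow, Complex.norm_natCast]
  gcongr

theorem norm_gf_le (hw : Summable fun T => (w T : ℝ) * x ^ T.size) {z : ℂ} (hz : ‖z‖ ≤ x) :
    ‖gf w z‖ ≤ ∑' T, (w T : ℝ) * x ^ T.size := by
  refine tsum_of_norm_bounded hw.hasSum fun T => ?_
  rw [norm_mul, norm_pow, Complex.norm_natCast]
  gcongr

theorem hasSum_gf (hw : Summable fun T => (w T : ℝ) * x ^ T.size) {z : ℂ} (hz : ‖z‖ ≤ x) :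
    HasSum (fun T : PlaneTree => (w T : ℂ) * z ^ T.size) (gf w z) :=
  (summable_norm_gf hw hz).of_norm.hasSum

theorem continuousOn_gf (hw : Summable fun T => (w T : ℝ) * x ^ T.size) :
    ContinuousOn (gf w) (Metric.closedBall 0 x) := by
  refine continuousOn_tsum (fun T => by fun_prop) hw fun T z hz => ?_
  rw [mem_closedBall_zero_iff] at hz
  rw [norm_mul, norm_pow, Complex.norm_natCast]
  gcongr

theorem gf_add {f v : PlaneTree → ℕ} (h : ∀ T, f T = v T + w T)
    (hv : Summable fun T => (v T : ℝ) * x ^ T.size)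
    (hw : Summable fun T => (w T : ℝ) * x ^ T.size) {z : ℂ} (hz : ‖z‖ ≤ x) :
    gf f z = gf v z + gf w z := by
  rw [gf, gf, gf, ← (hasSum_gf hv hz).summable.tsum_add (hasSum_gf hw hz).summable]
  simp only [h, Nat.cast_add, add_mul]

/-- Summation by splitting off the first branch. -/
theorem gf_eq_of_mul_add_mul {f a b c d : PlaneTree → ℕ} (h0 : f (node []) = 1)
    (h : ∀ T T', f (consEquiv (some (T, T'))) = a T * b T' + c T * d T')
    (ha : Summable fun T => (a T : ℝ) * x ^ T.size)
    (hb : Summable fun T => (b T : ℝ) * x ^ T.size)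
    (hc : Summable fun T => (c T : ℝ) * x ^ T.size)
    (hd : Summable fun T => (d T : ℝ) * x ^ T.size) {z : ℂ} (hz : ‖z‖ ≤ x) :
    gf f z = z + gf a z * gf b z + gf c z * gf d z := by
  have na := summable_norm_gf ha hz
  have nb := summable_norm_gf hb hz
  have nc := summable_norm_gf hc hz
  have nd := summable_norm_gf hd hz
  have h1 := (summable_mul_of_summable_norm na nb).hasSum
  have h2 := (summable_mul_of_summable_norm nc nd).hasSum
  rw [← tsum_mul_tsum_of_summable_norm na nb] at h1
  rw [← tsum_mul_tsum_of_summable_norm nc nd] at h2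
  have h4 : HasSum (fun q => (f (consEquiv (some q)) : ℂ) * z ^ (consEquiv (some q)).size)
      (gf a z * gf b z + gf c z * gf d z) := by
    refine (h1.add h2).congr_fun fun ⟨T, T'⟩ => ?_
    simp only [h, size_consEquiv]
    push_cast
    ring
  have h3 := hasSum_option (g := fun o => (f (consEquiv o) : ℂ) * z ^ (consEquiv o).size) h4
  rw [show f (consEquiv none) = 1 from h0, size_consEquiv_none, Nat.cast_one, one_mul,
    pow_one] at h3
  rw [gf, ← consEquiv.tsum_eq, h3.tsum_eq, add_assoc]

end Convergent

/-! ### Rational parametrization -/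

/-- The function `φ` of the equation `m = z φ(m)` satisfied by the parameter `m`. -/
def phi {K : Type*} [CommRing K] (m : K) : K := (1 + m ^ 2) ^ 2 * (1 + m + m ^ 2) ^ 3

/-- `∑ σ₂ Z₂ z ^ |T|` as a function of the parameter. -/
def paramS {K : Type*} [Field K] (m : K) : K := m / ((1 + m ^ 2) * (1 + m + m ^ 2))

/-- `∑ σ Z z ^ |T|` as a function of the parameter. -/
def paramP {K : Type*} [Field K] (m : K) : K := 1 - 1 / ((1 + m ^ 2) * (1 + m + m ^ 2) ^ 2)

/-- The critical value of the parameter is a root of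
`φ(m) - m φ'(m) = (1 + m ^ 2) (1 + m + m ^ 2) ^ 2 (1 - 2 m - 8 m ^ 2 - 6 m ^ 3 - 9 m ^ 4)`. -/
theorem exists_critPt : ∃ t : ℝ, 0.232617923 < t ∧ t < 0.232617924 ∧
    9 * t ^ 4 + 6 * t ^ 3 + 8 * t ^ 2 + 2 * t = 1 := by
  have hc : ContinuousOn (fun t : ℝ => 9 * t ^ 4 + 6 * t ^ 3 + 8 * t ^ 2 + 2 * t)
      (Set.Icc 0.232617923 0.232617924) := by fun_prop
  obtain ⟨t, ht, h⟩ := intermediate_value_Ioo (by norm_num) hc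
    (show (1 : ℝ) ∈ Set.Ioo _ _ from ⟨by norm_num, by norm_num⟩)
  exact ⟨t, ht.1, ht.2, h⟩

/-- The critical value of the parameter. -/
noncomputable def critPt : ℝ := Classical.choose exists_critPt

theorem lt_critPt : 0.232617923 < critPt := (Classical.choose_spec exists_critPt).1
theorem critPt_lt : critPt < 0.232617924 := (Classical.choose_spec exists_critPt).2.1
theorem critPt_eq : 9 * critPt ^ 4 + 6 * critPt ^ 3 + 8 * critPt ^ 2 + 2 * critPt = 1 :=
  (Classical.choose_spec exists_critPt).2.2
theorem critPt_pos : 0 < critPt := lt_trans (by norm_num) lt_critPt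

theorem phi_pos {t : ℝ} (ht : 0 ≤ t) : 0 < phi t := by
  unfold phi
  positivity

/-- The radius of convergence of the generating functions. -/
noncomputable def critVal : ℝ := critPt / phi critPt

theorem critVal_pos : 0 < critVal := div_pos critPt_pos (phi_pos critPt_pos.le)

theorem critVal_mul_phi : critVal * phi critPt = critPt :=
  div_mul_cancel₀ _ (phi_pos critPt_pos.le).ne'

/-- The parametrized solution of the system bounds the generating functions at `critVal`. -/
theorem partialGF_critVal_le (n : ℕ) :
    partialGF wR critVal n ≤ 1 - 1 / ((1 + critPt ^ 2) * (1 + critPt + critPt ^ 2)) ∧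
    partialGF wS critVal n ≤ paramS critPt ∧
    partialGF wU critVal n ≤ critPt / ((1 + critPt ^ 2) * (1 + critPt + critPt ^ 2) ^ 2) ∧
    partialGF wY critVal n ≤
      (critPt + critPt ^ 2) / ((1 + critPt ^ 2) * (1 + critPt + critPt ^ 2) ^ 2) := by
  have h0 := critPt_pos
  have hv : critVal = critPt / ((1 + critPt ^ 2) ^ 2 * (1 + critPt + critPt ^ 2) ^ 3) := rfl
  have hv0 := critVal_pos.le
  have h1 : 1 + critPt ^ 2 ≠ 0 := by positivity
  have h2 : 1 + critPt + critPt ^ 2 ≠ 0 := by positivity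
  have h3 : 1 ≤ (1 + critPt ^ 2) * (1 + critPt + critPt ^ 2) := by
    nlinarith [mul_pos h0 h0, mul_pos (mul_pos h0 h0) h0, mul_pos (mul_pos h0 h0) (mul_pos h0 h0)]
  have hr : 0 ≤ 1 - 1 / ((1 + critPt ^ 2) * (1 + critPt + critPt ^ 2)) := by
    rw [sub_nonneg]
    exact div_le_one_of_le₀ h3 (by positivity)
  have hs : 0 ≤ paramS critPt := by
    unfold paramS
    positivity
  refine partialGF_le_of_system (x := critVal) hv0 (add_nonneg hr ?_) (add_nonneg hs ?_) hr hs
    rfl rfl ?_ ?_ ?_ ?_ ?_ ?_ n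
  any_goals positivity
  all_goals rw [hv]; try unfold paramS
  all_goals field_simp; ring

theorem summable_wR : Summable fun T => (wR T : ℝ) * critVal ^ T.size :=
  (summable_of_partialGF_le critVal_pos.le fun n => (partialGF_critVal_le n).1).1

theorem summable_wS : Summable fun T => (wS T : ℝ) * critVal ^ T.size :=
  (summable_of_partialGF_le critVal_pos.le fun n => (partialGF_critVal_le n).2.1).1

theorem summable_wU : Summable fun T => (wU T : ℝ) * critVal ^ T.size :=
  (summable_of_partialGF_le critVal_pos.le fun n => (partialGF_critVal_le n).2.2.1).1

theorem summable_wY : Summable fun T => (wY T : ℝ) * critVal ^ T.size :=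
  (summable_of_partialGF_le critVal_pos.le fun n => (partialGF_critVal_le n).2.2.2).1

theorem summable_wP_and_le : Summable (fun T => (wP T : ℝ) * critVal ^ T.size) ∧
    ∑' T, (wP T : ℝ) * critVal ^ T.size ≤ paramP critPt := by
  refine summable_of_partialGF_le critVal_pos.le fun n => ?_
  have h0 := critPt_pos
  rw [partialGF_add wP_eq]
  refine (add_le_add (partialGF_critVal_le n).1 (partialGF_critVal_le n).2.2.2).trans (le_of_eq ?_)
  unfold paramP
  field_simp
  ring

theorem summable_wQ : Summable fun T => (wQ T : ℝ) * critVal ^ T.size := by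
  refine (summable_wS.add summable_wU).congr fun T => ?_
  rw [wQ_eq]
  push_cast
  ring

variable {z : ℂ}

/-- The parameter as a function of `z`: `m = z / ((1 - ∑ σ Z z ^ |T|) (1 - ∑ σ₂ Z z ^ |T|))`. -/
noncomputable def param (z : ℂ) : ℂ := z / ((1 - gf wP z) * (1 - gf wR z))

theorem le_norm_one_sub_gf_wP (hz : ‖z‖ ≤ critVal) :
    1 / ((1 + critPt ^ 2) * (1 + critPt + critPt ^ 2) ^ 2) ≤ ‖1 - gf wP z‖ := by
  have h1 := (norm_gf_le summable_wP_and_le.1 hz).trans summable_wP_and_le.2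
  have h2 := norm_sub_norm_le 1 (gf wP z)
  rw [norm_one] at h2
  unfold paramP at h1
  linarith

theorem le_norm_one_sub_gf_wR (hz : ‖z‖ ≤ critVal) :
    1 / ((1 + critPt ^ 2) * (1 + critPt + critPt ^ 2)) ≤ ‖1 - gf wR z‖ := by
  have h1 := (norm_gf_le summable_wR hz).trans
    (summable_of_partialGF_le critVal_pos.le fun n => (partialGF_critVal_le n).1).2
  have h2 := norm_sub_norm_le 1 (gf wR z)
  rw [norm_one] at h2
  linarith

theorem one_sub_gf_wP_ne_zero (hz : ‖z‖ ≤ critVal) : 1 - gf wP z ≠ 0 := by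
  have := critPt_pos
  exact norm_pos_iff.1 (lt_of_lt_of_le (by positivity) (le_norm_one_sub_gf_wP hz))

theorem one_sub_gf_wR_ne_zero (hz : ‖z‖ ≤ critVal) : 1 - gf wR z ≠ 0 := by
  have := critPt_pos
  exact norm_pos_iff.1 (lt_of_lt_of_le (by positivity) (le_norm_one_sub_gf_wR hz))

theorem norm_param_le (hz : ‖z‖ ≤ critVal) : ‖param z‖ ≤ critPt := by
  have h0 := critPt_pos
  have h1 := le_norm_one_sub_gf_wP hz
  have h2 := le_norm_one_sub_gf_wR hz
  rw [param, norm_div, norm_mul]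
  have h3 := critVal_pos
  have h4 : ‖z‖ / (‖1 - gf wP z‖ * ‖1 - gf wR z‖) ≤
      critVal / (1 / ((1 + critPt ^ 2) * (1 + critPt + critPt ^ 2) ^ 2) *
        (1 / ((1 + critPt ^ 2) * (1 + critPt + critPt ^ 2)))) := by gcongr
  refine h4.trans (le_of_eq ?_)
  rw [critVal, phi]
  field_simp

theorem continuousOn_param : ContinuousOn param (Metric.closedBall 0 critVal) := by
  refine continuousOn_id.div ((continuousOn_const.sub (continuousOn_gf summable_wP_and_le.1)).mul
    (continuousOn_const.sub (continuousOn_gf summable_wR))) fun z hz => ?_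
  rw [mem_closedBall_zero_iff] at hz
  exact mul_ne_zero (one_sub_gf_wP_ne_zero hz) (one_sub_gf_wR_ne_zero hz)

/-- The system of the generating functions, solved in terms of the parameter. -/
theorem param_spec (hz : ‖z‖ ≤ critVal) :
    z * phi (param z) = param z ∧ gf wS z = paramS (param z) ∧ gf wP z = paramP (param z) := by
  have hp := one_sub_gf_wP_ne_zero hz
  have hr := one_sub_gf_wR_ne_zero hz
  have hm : param z * ((1 - gf wP z) * (1 - gf wR z)) = z :=
    div_mul_cancel₀ _ (mul_ne_zero hp hr)
  have eP : gf wP z = gf wR z + gf wY z := gf_add wP_eq summable_wR summable_wY hz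
  have eQ : gf wQ z = gf wS z + gf wU z := gf_add wQ_eq summable_wS summable_wU hz
  have hzero : Summable fun T : PlaneTree => (((fun _ => 0 : PlaneTree → ℕ) T : ℕ) : ℝ)
      * critVal ^ T.size := by simp
  have gzero : gf (fun _ => 0) z = 0 := by simp [gf]
  have eR := gf_eq_of_mul_add_mul wR_nil wR_cons summable_wP_and_le.1 summable_wR summable_wQ
    summable_wS hz
  have eS := gf_eq_of_mul_add_mul (c := fun _ => 0) (d := fun _ => 0) wS_nil
    (by simpa using wS_cons) summable_wP_and_le.1 summable_wS hzero hzero hz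
  have eU := gf_eq_of_mul_add_mul (c := fun _ => 0) (d := fun _ => 0) wU_nil
    (by simpa using wU_cons) summable_wR summable_wU hzero hzero hz
  have eY := gf_eq_of_mul_add_mul wY_nil wY_cons summable_wR summable_wY summable_wS
    summable_wU hz
  rw [gzero, mul_zero, add_zero] at eS eU
  generalize param z = m at *
  generalize gf wP z = P at *
  generalize gf wQ z = Q at *
  generalize gf wR z = R at *
  generalize gf wS z = S at *
  generalize gf wU z = U at *
  generalize gf wY z = Y at *
  have hS : S = m * (1 - R) := mul_right_cancel₀ hp (by linear_combination eS - hm)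
  have hU : U = m * (1 - P) := mul_right_cancel₀ hr (by linear_combination eU - hm)
  have h1 : 1 - R = (1 - P) * (1 + m + m ^ 2) := by
    refine mul_right_cancel₀ hr ?_
    subst eP eQ hS hU
    linear_combination eY - hm
  have h2 : (1 - P) * ((1 + m ^ 2) * (1 + m + m ^ 2) ^ 2) = 1 := by
    refine mul_right_cancel₀ hp ?_
    rw [eQ, hS, hU] at eR
    have hR' : R = 1 - (1 - P) * (1 + m + m ^ 2) := by rw [← h1]; ring
    rw [← hm, hR'] at eR
    linear_combination -eR
  have hne : (1 + m ^ 2) * (1 + m + m ^ 2) ^ 2 ≠ 0 := fun h => by simp [h] at h2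
  have hne1 : 1 + m ^ 2 ≠ 0 := left_ne_zero_of_mul hne
  have hne2 : 1 + m + m ^ 2 ≠ 0 := fun h => by simp [h] at hne
  have hP : 1 - P = 1 / ((1 + m ^ 2) * (1 + m + m ^ 2) ^ 2) := eq_div_of_mul_eq hne h2
  refine ⟨?_, ?_, ?_⟩
  · rw [← hm, h1, hP, phi]
    field_simp
  · rw [hS, h1, hP, paramS]
    field_simp
  · rw [paramP, ← hP]
    ring

end PlaneTree

/-! ### Holomorphic functions of the square root -/

theorem sq_cpow_half (z : ℂ) : (z ^ (1 / 2 : ℂ)) ^ 2 = z := by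
  rw [one_div]
  exact Complex.cpow_ofNat_inv_pow z 2

theorem norm_sq_cpow_half (z : ℂ) : ‖z ^ (1 / 2 : ℂ)‖ ^ 2 = ‖z‖ := by
  rw [← norm_pow, sq_cpow_half]

theorem cpow_half_ne_zero {w : ℂ} (h : w ≠ 0) : w ^ (1 / 2 : ℂ) ≠ 0 := fun h0 => h <| by
  rw [← sq_cpow_half w, h0]
  simp

theorem ofReal_cpow_half {x : ℝ} (hx : 0 ≤ x) : (x : ℂ) ^ (1 / 2 : ℂ) = (√x : ℝ) := by
  rw [Real.sqrt_eq_rpow, Complex.ofReal_cpow hx]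
  norm_num

theorem cpow_half_re_nonneg (z : ℂ) : 0 ≤ (z ^ (1 / 2 : ℂ)).re := by
  rcases eq_or_ne z 0 with rfl | hz
  · simp
  have h : z ^ (1 / 2 : ℂ) = Complex.exp (Complex.log z / 2) := by
    rw [Complex.cpow_def_of_ne_zero hz]
    ring_nf
  have him : (Complex.log z / 2).im = z.arg / 2 := by simp [Complex.log_im]
  rw [h, Complex.exp_re, him]
  refine mul_nonneg (Real.exp_pos _).le (Real.cos_nonneg_of_mem_Icc ⟨?_, ?_⟩)
  · linarith [Complex.neg_pi_lt_arg z]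
  · linarith [Complex.arg_le_pi z]

theorem analyticAt_cpow_half {z : ℂ} (hz : z ∈ Complex.slitPlane) :
    AnalyticAt ℂ (fun z : ℂ => z ^ (1 / 2 : ℂ)) z :=
  analyticAt_id.cpow analyticAt_const hz

/-- The even and the odd part of a function analytic at `0`, as functions of the square. -/
theorem AnalyticAt.exists_even_odd {F : ℂ → ℂ} (hF : AnalyticAt ℂ F 0) :
    ∃ G H : ℂ → ℂ, AnalyticAt ℂ G 0 ∧ AnalyticAt ℂ H 0 ∧ G 0 = F 0 ∧ H 0 = deriv F 0 ∧
      ∀ᶠ w in 𝓝 (0 : ℂ), F w = G (w ^ 2) + w * H (w ^ 2) := by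
  obtain ⟨p, hp⟩ := hF
  have hsum := hasFPowerSeriesAt_iff.1 hp
  simp only [zero_add, smul_eq_mul] at hsum
  obtain ⟨r, hr, hball⟩ := Metric.eventually_nhds_iff.1 hsum
  have heven : ∀ w : ℂ, dist w 0 < r → Summable fun n => (w ^ 2) ^ n * p.coeff (2 * n) := by
    intro w hw
    refine ((hball hw).summable.comp_injective
      (mul_right_injective₀ (two_ne_zero (α := ℕ)))).congr fun n => ?_
    simp [pow_mul]
  have hodd : ∀ w : ℂ, dist w 0 < r → Summable fun n => (w ^ 2) ^ n * p.coeff (2 * n + 1) := by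
    intro w hw
    rcases eq_or_ne w 0 with rfl | hw0
    · refine summable_of_ne_finset_zero (s := {0}) fun n hn => ?_
      simp only [Finset.mem_singleton] at hn
      simp [hn]
    · refine (((hball hw).summable.comp_injective (i := fun n : ℕ => 2 * n + 1)
        fun a b h => by simpa using h).mul_left w⁻¹).congr fun n => ?_
      simp only [Function.comp_apply, pow_succ, pow_mul]
      field_simp
  have hroot : ∀ c : ℕ → ℂ, (∀ w : ℂ, dist w 0 < r → Summable fun n => (w ^ 2) ^ n * c n) →
      HasFPowerSeriesAt (fun u => ∑' n, u ^ n * c n) (FormalMultilinearSeries.ofScalars ℂ c) 0 := by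
    intro c hc
    refine hasFPowerSeriesAt_iff.2 (Metric.eventually_nhds_iff.2 ⟨r ^ 2, by positivity, ?_⟩)
    intro u hu
    have hw : dist (u ^ (1 / 2 : ℂ)) 0 < r := by
      rw [dist_zero_right] at hu ⊢
      rw [← norm_sq_cpow_half] at hu
      exact lt_of_pow_lt_pow_left₀ 2 hr.le hu
    have := (hc _ hw).hasSum
    rw [sq_cpow_half] at this
    simpa using this
  refine ⟨_, _, (hroot _ heven).analyticAt, (hroot _ hodd).analyticAt, ?_, ?_, ?_⟩
  · have h0 := (hball (y := 0) (by simpa using hr)).tsum_eq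
    rw [← h0, tsum_eq_single 0 (by intro n hn; simp [hn]),
      tsum_eq_single 0 (by intro n hn; simp [hn])]
  · rw [hp.deriv, tsum_eq_single 0 (by intro n hn; simp [hn])]
    rw [pow_zero, one_mul]
    rfl
  · refine Metric.eventually_nhds_iff.2 ⟨r, hr, fun w hw => ?_⟩
    have h1 := (heven w hw).hasSum
    have h2 := (hodd w hw).hasSum.mul_left w
    refine (hball hw).unique (HasSum.even_add_odd ?_ ?_)
    · simpa [pow_mul] using h1
    · refine h2.congr_fun fun n => ?_
      rw [pow_succ, pow_mul]
      ring

/-- A holomorphic function that is injective on a compact set and has no critical points there has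
a holomorphic inverse near the image of that set. -/
theorem exists_analytic_inverse {W : ℂ → ℂ} {D L : Set ℂ} (hD : IsOpen D)
    (hW : DifferentiableOn ℂ W D) (hL : IsCompact L) (hLD : L ⊆ D) (hinj : Set.InjOn W L)
    (hder : ∀ m ∈ L, deriv W m ≠ 0) :
    ∃ (O : Set ℂ) (M : ℂ → ℂ), IsOpen O ∧ W '' L ⊆ O ∧ AnalyticOnNhd ℂ M O ∧ Set.MapsTo M O D ∧
      (∀ m ∈ L, M (W m) = m) ∧ ∀ m ∈ L, HasDerivAt M (deriv W m)⁻¹ (W m) := by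
  have hWa : AnalyticOnNhd ℂ W D := hW.analyticOnNhd hD
  have hst : ∀ m ∈ D, HasStrictDerivAt W (deriv W m) m := fun m hm => (hWa m hm).hasStrictDerivAt
  obtain ⟨t, ht, hLt, htinj⟩ := hinj.exists_isOpen_superset hL
    (fun m hm => (hWa m (hLD hm)).continuousAt) fun m hm => by
      have := (hst m (hLD hm)).eventually_left_inverse (hder m hm)
      refine ⟨_, this, fun a ha b hb hab => ?_⟩
      have ha' : _ = a := ha
      have hb' : _ = b := hb
      rw [← ha', ← hb', hab]
  have hVo : IsOpen (D ∩ deriv W ⁻¹' {0}ᶜ) :=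
    hWa.deriv.continuousOn.isOpen_inter_preimage hD isOpen_compl_singleton
  set V := t ∩ (D ∩ deriv W ⁻¹' {0}ᶜ) with hV
  have hVopen : IsOpen V := ht.inter hVo
  have hLV : L ⊆ V := fun m hm => ⟨hLt hm, hLD hm, hder m hm⟩
  have hVinj : Set.InjOn W V := htinj.mono Set.inter_subset_left
  have hleft : ∀ m ∈ V, Function.invFunOn W V (W m) = m := fun m hm => hVinj.leftInvOn_invFunOn hm
  have hderiv : ∀ m ∈ V, HasDerivAt (Function.invFunOn W V) (deriv W m)⁻¹ (W m) := fun m hm =>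
    ((hst m hm.2.1).to_local_left_inverse hm.2.2
      (eventually_of_mem (hVopen.mem_nhds hm) hleft)).hasDerivAt
  have hO : IsOpen (W '' V) := by
    rw [isOpen_iff_mem_nhds]
    rintro _ ⟨m, hm, rfl⟩
    rw [← (hst m hm.2.1).map_nhds_eq hm.2.2]
    exact image_mem_map (hVopen.mem_nhds hm)
  refine ⟨W '' V, Function.invFunOn W V, hO, Set.image_mono hLV, ?_, ?_,
    fun m hm => hleft m (hLV hm), fun m hm => hderiv m (hLV hm)⟩
  · refine DifferentiableOn.analyticOnNhd ?_ hO
    rintro _ ⟨m, hm, rfl⟩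
    exact (hderiv m hm).differentiableAt.differentiableWithinAt
  · rintro _ ⟨m, hm, rfl⟩
    rw [hleft m hm]
    exact hm.2.1

/-- The image of the closed unit disc under `z ↦ √(1 - z)`. -/
def sqrtDisc : Set ℂ := {w | 0 ≤ w.re ∧ ‖1 - w ^ 2‖ ≤ 1}

theorem isBounded_sqrtDisc_enlarged (c : ℝ) :
    Bornology.IsBounded {w : ℂ | 0 ≤ w.re ∧ ‖1 - w ^ 2‖ ≤ c} := by
  refine (Metric.isBounded_closedBall (x := (0 : ℂ)) (r := c + 2)).subset ?_
  rintro w ⟨-, hw⟩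
  rw [mem_closedBall_zero_iff]
  have h1 : ‖w‖ ^ 2 ≤ c + 1 := by
    have := norm_sub_le (1 : ℂ) (1 - w ^ 2)
    rw [sub_sub_cancel, norm_pow, norm_one] at this
    linarith
  nlinarith [norm_nonneg w, sq_nonneg (‖w‖ - 1)]

theorem isClosed_sqrtDisc_enlarged (c : ℝ) : IsClosed {w : ℂ | 0 ≤ w.re ∧ ‖1 - w ^ 2‖ ≤ c} :=
  (isClosed_le continuous_const Complex.continuous_re).inter
    (isClosed_le (f := fun w : ℂ => ‖1 - w ^ 2‖) (by fun_prop) continuous_const)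

theorem isCompact_sqrtDisc : IsCompact sqrtDisc :=
  Metric.isCompact_of_isClosed_isBounded (isClosed_sqrtDisc_enlarged 1)
    (isBounded_sqrtDisc_enlarged 1)

/-- A neighborhood of `sqrtDisc` contains the image of a larger, slit disc. -/
theorem exists_enlargement {O : Set ℂ} (hO : IsOpen O) (hK : sqrtDisc ⊆ O) :
    ∃ ε > 0, ∀ w : ℂ, 0 ≤ w.re → ‖1 - w ^ 2‖ < 1 + ε → w ∈ O := by
  have hC : IsCompact ({w : ℂ | 0 ≤ w.re ∧ ‖1 - w ^ 2‖ ≤ 2} \ O) :=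
    (Metric.isCompact_of_isClosed_isBounded (isClosed_sqrtDisc_enlarged 2)
      (isBounded_sqrtDisc_enlarged 2)).diff hO
  rcases ({w : ℂ | 0 ≤ w.re ∧ ‖1 - w ^ 2‖ ≤ 2} \ O).eq_empty_or_nonempty with he | hne
  · refine ⟨1, one_pos, fun w h1 h2 => ?_⟩
    by_contra hw
    have : w ∈ {w : ℂ | 0 ≤ w.re ∧ ‖1 - w ^ 2‖ ≤ 2} \ O := ⟨⟨h1, by linarith⟩, hw⟩
    rw [he] at this
    exact this
  · obtain ⟨w₀, hw₀, hmin⟩ := hC.exists_isMinOn hne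
      (f := fun w => ‖1 - w ^ 2‖) (by fun_prop)
    have h1 : 1 < ‖1 - w₀ ^ 2‖ := by
      by_contra! h
      exact hw₀.2 (hK ⟨hw₀.1.1, h⟩)
    refine ⟨‖1 - w₀ ^ 2‖ - 1, by linarith, fun w hre hw => ?_⟩
    by_contra hwO
    have h2 : ‖1 - w₀ ^ 2‖ ≤ 2 := hw₀.1.2
    have : ‖1 - w₀ ^ 2‖ ≤ ‖1 - w ^ 2‖ := hmin (a := w) ⟨⟨hre, by linarith⟩, hwO⟩
    linarith

theorem one_sub_div_mem_slitPlane {z : ℂ} {z₀ : ℝ} (h0 : 0 < z₀) (h : ¬ (z.im = 0 ∧ z₀ ≤ z.re)) :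
    1 - z / z₀ ∈ Complex.slitPlane := by
  rw [Complex.mem_slitPlane_iff]
  simp only [Complex.sub_re, Complex.one_re, Complex.div_ofReal_re, Complex.sub_im,
    Complex.one_im, Complex.div_ofReal_im]
  by_cases him : z.im = 0
  · left
    have : z.re < z₀ := not_le.1 fun h' => h ⟨him, h'⟩
    rw [sub_pos, div_lt_one h0]
    exact this
  · right
    rw [zero_sub, neg_ne_zero]
    exact div_ne_zero him h0.ne'

/-- A generating function that is holomorphic in `√(1 - z / z₀)`, on a neighborhood of the values
this takes on the closed disc, has a dominant square-root singularity. -/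
theorem hasDominantSqrtSingularity_of_sqrt {w : PlaneTree → ℕ} {z₀ a b : ℝ} (h0 : 0 < z₀)
    (hb : b ≠ 0) {F : ℂ → ℂ} {O : Set ℂ} (hO : IsOpen O) (hK : sqrtDisc ⊆ O)
    (hF : AnalyticOnNhd ℂ F O) (ha : F 0 = a) (hd : deriv F 0 = -b)
    (hsum : ∀ z : ℂ, ‖z‖ < z₀ → HasSum (fun T : PlaneTree => (w T : ℂ) * z ^ T.size)
      (F ((1 - z / z₀) ^ (1 / 2 : ℂ)))) :
    PlaneTree.HasDominantSqrtSingularity w z₀ a b := by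
  obtain ⟨ε, hε, hεO⟩ := exists_enlargement hO hK
  have hz₀ : (z₀ : ℂ) ≠ 0 := by exact_mod_cast h0.ne'
  have h0O : (0 : ℂ) ∈ O := hK ⟨by simp, by simp⟩
  obtain ⟨G, H, hG, hH, hG0, hH0, hGH⟩ := (hF 0 h0O).exists_even_odd
  have hlin : AnalyticAt ℂ (fun z : ℂ => 1 - z / z₀) z₀ := by fun_prop
  have hlin0 : (1 - (z₀ : ℂ) / z₀) = 0 := by rw [div_self hz₀, sub_self]
  refine ⟨h0, hb, ε * z₀, fun z => F ((1 - z / z₀) ^ (1 / 2 : ℂ)), fun z => G (1 - z / z₀),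
    fun z => -H (1 - z / z₀), by positivity, hsum, ?_, ?_, ?_, ?_, ?_, ?_⟩
  · rintro z ⟨hz, hslit⟩
    have hmem : (1 - z / z₀) ^ (1 / 2 : ℂ) ∈ O := by
      refine hεO _ (cpow_half_re_nonneg _) ?_
      rw [sq_cpow_half, sub_sub_cancel, norm_div, Complex.norm_real, Real.norm_of_nonneg h0.le,
        div_lt_iff₀ h0]
      linarith
    refine AnalyticAt.fun_comp (f := fun z : ℂ => (1 - z / z₀) ^ (1 / 2 : ℂ)) (hF _ hmem) ?_
    exact AnalyticAt.fun_comp (f := fun z : ℂ => 1 - z / z₀)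
      (analyticAt_cpow_half (one_sub_div_mem_slitPlane h0 hslit)) (by fun_prop)
  · exact AnalyticAt.fun_comp (f := fun z : ℂ => 1 - z / z₀) (by rwa [hlin0]) hlin
  · exact (AnalyticAt.fun_comp (f := fun z : ℂ => 1 - z / z₀) (by rwa [hlin0]) hlin).neg
  · simp only [hlin0, hG0, ha]
  · simp only [hlin0, hH0, hd, neg_neg]
  · have htend : Tendsto (fun z : ℂ => (1 - z / z₀) ^ (1 / 2 : ℂ)) (𝓝 (z₀ : ℂ)) (𝓝 0) := by
      rw [tendsto_zero_iff_norm_tendsto_zero]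
      have h1 : Tendsto (fun z : ℂ => √‖1 - z / z₀‖) (𝓝 (z₀ : ℂ)) (𝓝 0) := by
        have := (Real.continuous_sqrt.comp (by fun_prop : Continuous fun z : ℂ =>
          ‖1 - z / (z₀ : ℂ)‖)).tendsto (z₀ : ℂ)
        simpa [hlin0, Function.comp_def] using this
      refine h1.congr fun z => ?_
      rw [← norm_sq_cpow_half, Real.sqrt_sq (norm_nonneg _)]
    filter_upwards [htend.eventually hGH] with z hz _
    rw [hz, sq_cpow_half]
    ring

/-! ### The parameter as a holomorphic function of the square root -/

namespace PlaneTree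

/-- The second divided difference of `φ`: the polynomial `k` with
`φ(m) = φ(t) + φ'(t) (m - t) + (m - t) ^ 2 k(t, m)`. -/
def secondDiff {K : Type*} [CommRing K] (t m : K) : K :=
  (8 + 26 * t + 57 * t ^ 2 + 80 * t ^ 3 + 95 * t ^ 4 + 78 * t ^ 5 + 56 * t ^ 6 + 24 * t ^ 7
    + 9 * t ^ 8) +
  ((13 + 38 * t + 60 * t ^ 2 + 76 * t ^ 3 + 65 * t ^ 4 + 48 * t ^ 5 + 21 * t ^ 6
    + 8 * t ^ 7) * m ^ 1 +
  (19 + 40 * t + 57 * t ^ 2 + 52 * t ^ 3 + 40 * t ^ 4 + 18 * t ^ 5 + 7 * t ^ 6) * m ^ 2 +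
  (20 + 38 * t + 39 * t ^ 2 + 32 * t ^ 3 + 15 * t ^ 4 + 6 * t ^ 5) * m ^ 3 +
  (19 + 26 * t + 24 * t ^ 2 + 12 * t ^ 3 + 5 * t ^ 4) * m ^ 4 +
  (13 + 16 * t + 9 * t ^ 2 + 4 * t ^ 3) * m ^ 5 +
  (8 + 6 * t + 3 * t ^ 2) * m ^ 6 +
  (3 + 2 * t) * m ^ 7 +
  1 * m ^ 8)

theorem phi_eq_secondDiff {K : Type*} [CommRing K] (t m : K) :
    phi m = phi t + (4 * t * (1 + t ^ 2) * (1 + t + t ^ 2) ^ 3 +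
      3 * (1 + t ^ 2) ^ 2 * (1 + t + t ^ 2) ^ 2 * (1 + 2 * t)) * (m - t) +
      (m - t) ^ 2 * secondDiff t m := by
  unfold phi secondDiff
  ring

/-- As `φ(t) = t φ'(t)` at the critical point, `z₀ φ(m) - m` has a double zero there. -/
theorem critVal_mul_phi_sub (m : ℂ) :
    critVal * phi m - m = critVal * ((m - critPt) ^ 2 * secondDiff (critPt : ℂ) m) := by
  have h1 : (critVal : ℂ) * phi (critPt : ℂ) = critPt := by
    have := critVal_mul_phi
    unfold phi at this ⊢
    exact_mod_cast this
  have h2 : critVal * (4 * critPt * (1 + critPt ^ 2) * (1 + critPt + critPt ^ 2) ^ 3 +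
      3 * (1 + critPt ^ 2) ^ 2 * (1 + critPt + critPt ^ 2) ^ 2 * (1 + 2 * critPt)) = 1 := by
    refine mul_left_cancel₀ critPt_pos.ne' ?_
    have := critVal_mul_phi
    unfold phi at this
    linear_combination this + critVal * (1 + critPt ^ 2) * (1 + critPt + critPt ^ 2) ^ 2 * critPt_eq
  have h2' : (critVal : ℂ) * (4 * critPt * (1 + critPt ^ 2) * (1 + critPt + critPt ^ 2) ^ 3 +
      3 * (1 + critPt ^ 2) ^ 2 * (1 + critPt + critPt ^ 2) ^ 2 * (1 + 2 * critPt)) = 1 := by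
    exact_mod_cast h2
  rw [phi_eq_secondDiff (critPt : ℂ) m]
  linear_combination h1 + (m - critPt) * h2'

theorem norm_ofReal_mul_pow_le {c t : ℝ} (hc : 0 ≤ c) {m : ℂ} (hm : ‖m‖ ≤ t) (n : ℕ) :
    ‖(c : ℂ) * m ^ n‖ ≤ c * t ^ n := by
  rw [norm_mul, norm_pow, Complex.norm_real, Real.norm_of_nonneg hc]
  gcongr

theorem secondDiff_re_pos {m : ℂ} (hm : ‖m‖ ≤ critPt) : 0 < (secondDiff (critPt : ℂ) m).re := by
  have h0 := critPt_pos
  have hlt : critPt ≤ 0.2327 := critPt_lt.le.trans (by norm_num)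
  have hgt : 0.2326 ≤ critPt := le_trans (by norm_num) lt_critPt.le
  unfold secondDiff
  rw [Complex.add_re]
  -- The terms of positive degree in `m` are dominated by the constant term.
  set t := critPt with ht
  have hrest : ‖((13 + 38 * t + 60 * t ^ 2 + 76 * t ^ 3 + 65 * t ^ 4 + 48 * t ^ 5 + 21 * t ^ 6
      + 8 * t ^ 7) * m ^ 1 +
      (19 + 40 * t + 57 * t ^ 2 + 52 * t ^ 3 + 40 * t ^ 4 + 18 * t ^ 5 + 7 * t ^ 6) * m ^ 2 +
      (20 + 38 * t + 39 * t ^ 2 + 32 * t ^ 3 + 15 * t ^ 4 + 6 * t ^ 5) * m ^ 3 +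
      (19 + 26 * t + 24 * t ^ 2 + 12 * t ^ 3 + 5 * t ^ 4) * m ^ 4 +
      (13 + 16 * t + 9 * t ^ 2 + 4 * t ^ 3) * m ^ 5 +
      (8 + 6 * t + 3 * t ^ 2) * m ^ 6 + (3 + 2 * t) * m ^ 7 + 1 * m ^ 8 : ℂ)‖ ≤ 12 := by
    refine ((norm_add_le_of_le (norm_add_le_of_le (norm_add_le_of_le (norm_add_le_of_le
      (norm_add_le_of_le (norm_add_le_of_le (norm_add_le_of_le ?_ ?_) ?_) ?_) ?_) ?_) ?_) ?_).trans
      (b := (13 + 38 * t + 60 * t ^ 2 + 76 * t ^ 3 + 65 * t ^ 4 + 48 * t ^ 5 + 21 * t ^ 6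
      + 8 * t ^ 7) * t ^ 1 +
      (19 + 40 * t + 57 * t ^ 2 + 52 * t ^ 3 + 40 * t ^ 4 + 18 * t ^ 5 + 7 * t ^ 6) * t ^ 2 +
      (20 + 38 * t + 39 * t ^ 2 + 32 * t ^ 3 + 15 * t ^ 4 + 6 * t ^ 5) * t ^ 3 +
      (19 + 26 * t + 24 * t ^ 2 + 12 * t ^ 3 + 5 * t ^ 4) * t ^ 4 +
      (13 + 16 * t + 9 * t ^ 2 + 4 * t ^ 3) * t ^ 5 +
      (8 + 6 * t + 3 * t ^ 2) * t ^ 6 + (3 + 2 * t) * t ^ 7 + 1 * t ^ 8) ?_)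
    case refine_9 =>
      refine le_trans (b := (13 + 38 * 0.2327 + 60 * 0.2327 ^ 2 + 76 * 0.2327 ^ 3 + 65 * 0.2327 ^ 4
        + 48 * 0.2327 ^ 5 + 21 * 0.2327 ^ 6 + 8 * 0.2327 ^ 7) * 0.2327 ^ 1 +
      (19 + 40 * 0.2327 + 57 * 0.2327 ^ 2 + 52 * 0.2327 ^ 3 + 40 * 0.2327 ^ 4 + 18 * 0.2327 ^ 5
        + 7 * 0.2327 ^ 6) * 0.2327 ^ 2 +
      (20 + 38 * 0.2327 + 39 * 0.2327 ^ 2 + 32 * 0.2327 ^ 3 + 15 * 0.2327 ^ 4 + 6 * 0.2327 ^ 5)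
        * 0.2327 ^ 3 +
      (19 + 26 * 0.2327 + 24 * 0.2327 ^ 2 + 12 * 0.2327 ^ 3 + 5 * 0.2327 ^ 4) * 0.2327 ^ 4 +
      (13 + 16 * 0.2327 + 9 * 0.2327 ^ 2 + 4 * 0.2327 ^ 3) * 0.2327 ^ 5 +
      (8 + 6 * 0.2327 + 3 * 0.2327 ^ 2) * 0.2327 ^ 6 + (3 + 2 * 0.2327) * 0.2327 ^ 7
        + 1 * 0.2327 ^ 8) ?_ (by norm_num)
      gcongr
    all_goals
      refine le_trans (le_of_eq ?_) (norm_ofReal_mul_pow_le ?_ hm _)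
      · push_cast
        rfl
      · positivity
  have h1 := (Complex.abs_re_le_norm _).trans hrest
  rw [abs_le] at h1
  have h2 : ((8 + 26 * t + 57 * t ^ 2 + 80 * t ^ 3 + 95 * t ^ 4 + 78 * t ^ 5 + 56 * t ^ 6
      + 24 * t ^ 7 + 9 * t ^ 8 : ℂ)).re = 8 + 26 * t + 57 * t ^ 2 + 80 * t ^ 3 + 95 * t ^ 4
      + 78 * t ^ 5 + 56 * t ^ 6 + 24 * t ^ 7 + 9 * t ^ 8 := by
    rw [← Complex.ofReal_re (8 + 26 * t + 57 * t ^ 2 + 80 * t ^ 3 + 95 * t ^ 4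
      + 78 * t ^ 5 + 56 * t ^ 6 + 24 * t ^ 7 + 9 * t ^ 8)]
    push_cast
    rfl
  rw [h2]
  have h3 : 0 ≤ 80 * t ^ 3 + 95 * t ^ 4 + 78 * t ^ 5 + 56 * t ^ 6 + 24 * t ^ 7 + 9 * t ^ 8 := by
    positivity
  nlinarith [h1.1]

/-- The domain on which the square root of `1 - z / z₀` is holomorphic in the parameter. -/
def paramDomain : Set ℂ :=
  {m | 0 < (secondDiff (critPt : ℂ) m).re ∧ 0 < (1 + m + m ^ 2).re ∧ 1 + m ^ 2 ≠ 0}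

theorem isOpen_paramDomain : IsOpen paramDomain := by
  have h1 : Continuous fun m : ℂ => (secondDiff (critPt : ℂ) m).re := by
    unfold secondDiff
    exact Complex.continuous_re.comp (by fun_prop)
  have h2 : Continuous fun m : ℂ => (1 + m + m ^ 2).re := Complex.continuous_re.comp (by fun_prop)
  have h3 : Continuous fun m : ℂ => 1 + m ^ 2 := by fun_prop
  exact (isOpen_lt continuous_const h1).inter ((isOpen_lt continuous_const h2).inter
    (isOpen_ne_fun h3 continuous_const))

theorem mem_paramDomain {m : ℂ} (hm : ‖m‖ ≤ critPt) : m ∈ paramDomain := by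
  have hlt : critPt < 0.24 := critPt_lt.trans (by norm_num)
  have hm1 : ‖m‖ < 0.24 := hm.trans_lt hlt
  have hm2 : ‖m ^ 2‖ < 0.24 := by
    rw [norm_pow]
    nlinarith [norm_nonneg m]
  refine ⟨secondDiff_re_pos hm, ?_, fun h => ?_⟩
  · have h1 := (abs_le.1 (Complex.abs_re_le_norm m)).1
    have h2 := (abs_le.1 (Complex.abs_re_le_norm (m ^ 2))).1
    simp only [Complex.add_re, Complex.one_re]
    linarith
  · have : m ^ 2 = -1 := by linear_combination h
    rw [this, norm_neg, norm_one] at hm2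
    norm_num at hm2

theorem ne_zero_of_re_pos {w : ℂ} (h : 0 < w.re) : w ≠ 0 := by
  rintro rfl
  simp at h

theorem phi_ne_zero {m : ℂ} (hm : m ∈ paramDomain) : phi m ≠ 0 :=
  mul_ne_zero (pow_ne_zero _ hm.2.2) (pow_ne_zero _ (ne_zero_of_re_pos hm.2.1))

/-- A holomorphic branch of `√(1 - z / z₀)`, where `z = m / φ(m)`, divided by its zero
`critPt - m`. -/
noncomputable def rootFactor (m : ℂ) : ℂ :=
  secondDiff (critPt : ℂ) m ^ (1 / 2 : ℂ) /
    ((1 + m ^ 2) * (1 + m + m ^ 2) * (1 + m + m ^ 2) ^ (1 / 2 : ℂ))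

/-- A holomorphic branch of `√(1 - z / z₀)`, where `z = m / φ(m)`. -/
noncomputable def rootFun (m : ℂ) : ℂ := (critPt - m) * rootFactor m

theorem rootFactor_ne_zero {m : ℂ} (hm : m ∈ paramDomain) : rootFactor m ≠ 0 :=
  div_ne_zero (cpow_half_ne_zero (ne_zero_of_re_pos hm.1)) (mul_ne_zero (mul_ne_zero hm.2.2
    (ne_zero_of_re_pos hm.2.1)) (cpow_half_ne_zero (ne_zero_of_re_pos hm.2.1)))

theorem rootFactor_sq {m : ℂ} : rootFactor m ^ 2 = secondDiff (critPt : ℂ) m / phi m := by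
  rw [rootFactor, div_pow, sq_cpow_half, mul_pow, sq_cpow_half, phi]
  ring

theorem differentiableOn_rootFactor : DifferentiableOn ℂ rootFactor paramDomain := by
  intro m hm
  have h1 : DifferentiableAt ℂ (fun m => secondDiff (critPt : ℂ) m ^ (1 / 2 : ℂ)) m := by
    refine DifferentiableAt.cpow ?_ (differentiableAt_const _) (Or.inl hm.1)
    unfold secondDiff
    fun_prop
  have h2 : DifferentiableAt ℂ (fun m : ℂ => (1 + m + m ^ 2) ^ (1 / 2 : ℂ)) m :=
    DifferentiableAt.cpow (by fun_prop) (differentiableAt_const _) (Or.inl hm.2.1)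
  refine (h1.div (DifferentiableAt.mul (by fun_prop) h2) ?_).differentiableWithinAt
  exact mul_ne_zero (mul_ne_zero hm.2.2 (ne_zero_of_re_pos hm.2.1))
    (cpow_half_ne_zero (ne_zero_of_re_pos hm.2.1))

theorem differentiableOn_rootFun : DifferentiableOn ℂ rootFun paramDomain :=
  ((differentiableOn_const _).sub differentiableOn_id).mul differentiableOn_rootFactor

theorem rootFun_sq {m : ℂ} (hm : m ∈ paramDomain) :
    rootFun m ^ 2 = 1 - m / phi m / critVal := by
  have h1 := phi_ne_zero hm
  have h2 : (critVal : ℂ) ≠ 0 := by exact_mod_cast critVal_pos.ne'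
  have h3 := critVal_mul_phi_sub m
  rw [rootFun, mul_pow, rootFactor_sq]
  field_simp
  linear_combination -h3

theorem deriv_rootFun_critPt : deriv rootFun critPt = -rootFactor critPt := by
  have hm : (critPt : ℂ) ∈ paramDomain := mem_paramDomain (by
    rw [Complex.norm_real, Real.norm_of_nonneg critPt_pos.le])
  have h1 := (differentiableOn_rootFactor.differentiableAt
    (isOpen_paramDomain.mem_nhds hm)).hasDerivAt
  have h2 : HasDerivAt (fun m : ℂ => (critPt : ℂ) - m) (-1) critPt := by
    simpa using (hasDerivAt_id (critPt : ℂ)).const_sub (critPt : ℂ)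
  have h3 := (h2.mul h1).deriv
  simp only [sub_self, zero_mul, add_zero, neg_one_mul] at h3
  exact h3

theorem hasDerivAt_phi (m : ℂ) : HasDerivAt phi (4 * m * (1 + m ^ 2) * (1 + m + m ^ 2) ^ 3 +
      3 * (1 + m ^ 2) ^ 2 * (1 + m + m ^ 2) ^ 2 * (1 + 2 * m)) m := by
  have h1 : HasDerivAt (fun m : ℂ => 1 + m ^ 2) (2 * m) m := by
    simpa using (hasDerivAt_pow 2 m).const_add 1
  have h2 : HasDerivAt (fun m : ℂ => 1 + m + m ^ 2) (1 + 2 * m) m := by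
    simpa using ((hasDerivAt_id' m).const_add 1).fun_add (hasDerivAt_pow 2 m)
  have h3 := (h1.fun_pow 2).fun_mul (h2.fun_pow 3)
  refine h3.congr_deriv ?_
  push_cast
  ring

/-- Inside the critical circle, the polynomial `9 m ^ 4 + 6 m ^ 3 + 8 m ^ 2 + 2 m - 1` has no
zeros. -/
theorem deriv_rootFun_ne_zero {m : ℂ} (hm : ‖m‖ < critPt) : deriv rootFun m ≠ 0 := by
  intro h0
  have hD := mem_paramDomain hm.le
  have hnhds := isOpen_paramDomain.mem_nhds hD
  have hphi := phi_ne_zero hD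
  have hz : (critVal : ℂ) ≠ 0 := by exact_mod_cast critVal_pos.ne'
  have h1 := ((differentiableOn_rootFun.differentiableAt hnhds).hasDerivAt.pow 2)
  have h2 := ((((hasDerivAt_id m).div (hasDerivAt_phi m) hphi).div_const (critVal : ℂ)).const_sub 1)
  have h3 := h1.unique (h2.congr_of_eventuallyEq (eventually_of_mem hnhds fun x hx => rootFun_sq hx))
  rw [h0, mul_zero, eq_comm, neg_eq_zero, div_eq_zero_iff, or_iff_left hz, div_eq_zero_iff,
    or_iff_left (pow_ne_zero _ hphi)] at h3
  have h4 : (1 + m ^ 2) * (1 + m + m ^ 2) ^ 2 *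
      (1 - (9 * m ^ 4 + 6 * m ^ 3 + 8 * m ^ 2 + 2 * m)) = 0 := by
    rw [← h3, phi, id]
    ring
  have h5 : 9 * m ^ 4 + 6 * m ^ 3 + 8 * m ^ 2 + 2 * m = 1 := by
    rcases mul_eq_zero.1 h4 with h | h
    · exact absurd h (mul_ne_zero hD.2.2 (pow_ne_zero _ (ne_zero_of_re_pos hD.2.1)))
    · linear_combination -h
  have h6 : ‖9 * m ^ 4 + 6 * m ^ 3 + 8 * m ^ 2 + 2 * m‖ ≤
      9 * ‖m‖ ^ 4 + 6 * ‖m‖ ^ 3 + 8 * ‖m‖ ^ 2 + 2 * ‖m‖ := by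
    refine norm_add_le_of_le (norm_add_le_of_le (norm_add_le_of_le ?_ ?_) ?_) ?_ <;> simp
  have h7 : 9 * ‖m‖ ^ 4 + 6 * ‖m‖ ^ 3 + 8 * ‖m‖ ^ 2 + 2 * ‖m‖ < 1 := by
    rw [← critPt_eq]
    gcongr
  rw [h5, norm_one] at h6
  linarith

/-- On the boundary circle, the parameter is smaller than `critPt` except at the singularity. -/
theorem norm_param_lt {z : ℂ} (hz : ‖z‖ ≤ critVal) (hne : z ≠ critVal) : ‖param z‖ < critPt := by
  refine lt_of_le_of_ne (norm_param_le hz) fun heq => hne ?_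
  have h0 := critPt_pos
  have hspec := (param_spec hz).1
  generalize param z = m at heq hspec
  have h1 : ‖1 + m ^ 2‖ ≤ 1 + critPt ^ 2 := by
    refine norm_add_le_of_le (by simp) ?_
    rw [norm_pow, heq]
  have h2 : ‖1 + m + m ^ 2‖ ≤ ‖1 + m‖ + critPt ^ 2 := by
    refine norm_add_le_of_le le_rfl ?_
    rw [norm_pow, heq]
  have h3 : ‖1 + m‖ ≤ 1 + critPt := norm_add_le_of_le (by simp) heq.le
  -- Equality in `‖1 + m‖ ≤ 1 + ‖m‖` forces `m` to be a nonnegative real number.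
  have h4 : ¬ ‖1 + m‖ < 1 + critPt := by
    intro hlt
    have h5 : ‖1 + m + m ^ 2‖ < 1 + critPt + critPt ^ 2 := h2.trans_lt (by linarith)
    have h6 : ‖phi m‖ < phi critPt := by
      rw [phi, phi, norm_mul, norm_pow, norm_pow]
      calc ‖1 + m ^ 2‖ ^ 2 * ‖1 + m + m ^ 2‖ ^ 3
          ≤ (1 + critPt ^ 2) ^ 2 * ‖1 + m + m ^ 2‖ ^ 3 := by gcongr
        _ < (1 + critPt ^ 2) ^ 2 * (1 + critPt + critPt ^ 2) ^ 3 := by gcongr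
    have h7 := congrArg norm hspec
    rw [norm_mul, heq] at h7
    have h8 := critVal_mul_phi
    have h9 : ‖z‖ * ‖phi m‖ ≤ critVal * ‖phi m‖ := by gcongr
    have h10 : critVal * ‖phi m‖ < critVal * phi critPt := by
      have := critVal_pos
      gcongr
    linarith
  have h5 : ‖1 + m‖ = 1 + critPt := le_antisymm h3 (not_lt.1 h4)
  have h6 : m.re = critPt := by
    have e1 : ‖1 + m‖ ^ 2 = (1 + m.re) ^ 2 + m.im ^ 2 := by
      rw [Complex.sq_norm, Complex.normSq_apply]
      simp
      ring
    have e2 : ‖m‖ ^ 2 = m.re ^ 2 + m.im ^ 2 := by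
      rw [Complex.sq_norm, Complex.normSq_apply]
      ring
    rw [h5] at e1
    rw [heq] at e2
    linarith
  have h7 : m = critPt := by
    have e2 : ‖m‖ ^ 2 = m.re ^ 2 + m.im ^ 2 := by
      rw [Complex.sq_norm, Complex.normSq_apply]
      ring
    rw [heq, h6] at e2
    have h8 : m.im = 0 := by
      have : m.im ^ 2 = 0 := by linarith
      exact pow_eq_zero_iff (two_ne_zero) |>.1 this
    exact Complex.ext (by simp [h6]) (by simp [h8])
  have h8 : (critVal : ℂ) * phi m = m := by
    have := critVal_mul_phi
    rw [h7]
    unfold phi at this ⊢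
    exact_mod_cast this
  have hD : m ∈ paramDomain := mem_paramDomain heq.le
  exact mul_right_cancel₀ (phi_ne_zero hD) (hspec.trans h8.symm)

theorem rootFun_param_sq {z : ℂ} (hz : ‖z‖ ≤ critVal) : rootFun (param z) ^ 2 = 1 - z / critVal := by
  have hD := mem_paramDomain (norm_param_le hz)
  rw [rootFun_sq hD, div_eq_of_eq_mul (phi_ne_zero hD) (param_spec hz).1.symm]

theorem param_critVal : param critVal = critPt := by
  have hz : ‖(critVal : ℂ)‖ ≤ critVal := by
    rw [Complex.norm_real, Real.norm_of_nonneg critVal_pos.le]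
  have hz0 : (critVal : ℂ) ≠ 0 := by exact_mod_cast critVal_pos.ne'
  have h := rootFun_param_sq hz
  rw [div_self hz0, sub_self, sq_eq_zero_iff, rootFun, mul_eq_zero,
    or_iff_left (rootFactor_ne_zero (mem_paramDomain (norm_param_le hz))), sub_eq_zero] at h
  exact h.symm

theorem one_sub_div_re_pos {z : ℂ} {c : ℝ} (hc : 0 < c) (hz : ‖z‖ ≤ c) (hne : z ≠ c) :
    0 < (1 - z / c).re := by
  rw [Complex.sub_re, Complex.one_re, Complex.div_ofReal_re, sub_pos, div_lt_one hc]
  have h1 := (Complex.re_le_norm z).trans hz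
  refine lt_of_le_of_ne h1 fun h => hne ?_
  have h2 : z.im ^ 2 = 0 := by
    have h3 : ‖z‖ ^ 2 = z.re ^ 2 + z.im ^ 2 := by
      rw [Complex.sq_norm, Complex.normSq_apply]
      ring
    have h4 : ‖z‖ ^ 2 ≤ c ^ 2 := by gcongr
    rw [h] at h3
    nlinarith [sq_nonneg z.im]
  exact Complex.ext (by simp [h]) (by simpa using h2)

/-- The branch `rootFun` is the principal square root along the parameter. The signs agree at `0`
and hence, by connectedness, everywhere on the disc. -/
theorem rootFun_param {z : ℂ} (hz : ‖z‖ ≤ critVal) :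
    rootFun (param z) = (1 - z / critVal) ^ (1 / 2 : ℂ) := by
  have hz0 : (critVal : ℂ) ≠ 0 := by exact_mod_cast critVal_pos.ne'
  rcases eq_or_ne z critVal with rfl | hne
  · rw [param_critVal, rootFun, div_self hz0]
    simp
  set S : Set ℂ := Metric.closedBall 0 critVal \ {(critVal : ℂ)} with hS
  have hmem : ∀ {x : ℂ}, x ∈ S → ‖x‖ ≤ critVal ∧ x ≠ critVal := fun hx =>
    ⟨mem_closedBall_zero_iff.1 hx.1, hx.2⟩
  have h0S : (0 : ℂ) ∈ S := ⟨by simp [critVal_pos.le], hz0.symm⟩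
  have hconn : IsPreconnected S := by
    refine (StarConvex.isPathConnected (a := (0 : ℂ)) ?_ h0S).isConnected.isPreconnected
    rw [starConvex_zero_iff]
    intro x hx t ht0 ht1
    obtain ⟨h1, h2⟩ := hmem hx
    rcases eq_or_lt_of_le ht1 with rfl | ht1
    · rwa [one_smul]
    have h3 : ‖t • x‖ < critVal := by
      rw [norm_smul, Real.norm_of_nonneg ht0]
      have := critVal_pos
      nlinarith [norm_nonneg x]
    refine ⟨mem_closedBall_zero_iff.2 h3.le, fun h => ?_⟩
    rw [Set.mem_singleton_iff.1 h, Complex.norm_real, Real.norm_of_nonneg critVal_pos.le] at h3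
    exact lt_irrefl _ h3
  have hcont : ContinuousOn (fun x => rootFun (param x)) S := by
    refine differentiableOn_rootFun.continuousOn.comp
      (continuousOn_param.mono Set.sdiff_subset) fun x hx => ?_
    exact mem_paramDomain (norm_param_le (hmem hx).1)
  have hcont' : ContinuousOn (fun x : ℂ => (1 - x / critVal) ^ (1 / 2 : ℂ)) S := by
    refine ContinuousOn.cpow_const (by fun_prop) fun x hx => Or.inl ?_
    exact one_sub_div_re_pos critVal_pos (hmem hx).1 (hmem hx).2
  refine hconn.eq_of_sq_eq hcont hcont' (fun x hx => ?_) (fun {x} hx => ?_) h0S ?_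
    (⟨mem_closedBall_zero_iff.2 hz, hne⟩ : z ∈ S)
  · simp only [Pi.pow_apply]
    rw [rootFun_param_sq (hmem hx).1, sq_cpow_half]
  · exact cpow_half_ne_zero (ne_zero_of_re_pos
      (one_sub_div_re_pos critVal_pos (hmem hx).1 (hmem hx).2))
  · have hp0 : param 0 = 0 := by simp [param]
    have hsq := rootFun_param_sq (z := 0) (by simp [critVal_pos.le])
    have hpos : 0 < (rootFun (param 0)).re := by
      have hk : (0 : ℝ) < secondDiff critPt 0 := by
        have := critPt_pos
        unfold secondDiff
        positivity
      have hk' : secondDiff (critPt : ℂ) 0 = ((secondDiff critPt 0 : ℝ) : ℂ) := by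
        unfold secondDiff
        push_cast
        rfl
      rw [hp0, rootFun, rootFactor, hk', ofReal_cpow_half hk.le]
      simp only [sub_zero, ne_eq, OfNat.ofNat_ne_zero, not_false_eq_true, zero_pow, add_zero,
        Complex.one_cpow, mul_one, div_one, ← Complex.ofReal_mul, Complex.ofReal_re]
      exact mul_pos critPt_pos (Real.sqrt_pos.2 hk)
    simp only [zero_div, sub_zero, Complex.one_cpow] at hsq ⊢
    rcases sq_eq_one_iff.1 hsq with h | h
    · exact h
    · rw [h] at hpos
      norm_num at hpos

/-- The parameter is a holomorphic function `M` of `√(1 - z / z₀)`, on a neighborhood of the values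
this takes on the closed disc. -/
theorem exists_param_of_sqrt : ∃ (O : Set ℂ) (M : ℂ → ℂ) (c : ℝ), IsOpen O ∧ sqrtDisc ⊆ O ∧
    AnalyticOnNhd ℂ M O ∧ Set.MapsTo M O paramDomain ∧ M 0 = critPt ∧
    (∀ z : ℂ, ‖z‖ ≤ critVal → M ((1 - z / critVal) ^ (1 / 2 : ℂ)) = param z) ∧
    HasDerivAt M (-c) 0 ∧ 0 < c ∧ c ^ 2 * secondDiff critPt critPt = phi critPt := by
  have hz0 : (critVal : ℂ) ≠ 0 := by exact_mod_cast critVal_pos.ne'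
  have hcrit : (critVal : ℂ) ∈ Metric.closedBall (0 : ℂ) critVal := by
    rw [mem_closedBall_zero_iff, Complex.norm_real, Real.norm_of_nonneg critVal_pos.le]
  set L := param '' Metric.closedBall 0 critVal with hL
  have hcritL : (critPt : ℂ) ∈ L := ⟨critVal, hcrit, param_critVal⟩
  have hLD : L ⊆ paramDomain := by
    rintro _ ⟨z, hz, rfl⟩
    exact mem_paramDomain (norm_param_le (mem_closedBall_zero_iff.1 hz))
  have hinj : Set.InjOn rootFun L := by
    rintro _ ⟨z, hz, rfl⟩ _ ⟨z', hz', rfl⟩ h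
    have h1 := rootFun_param_sq (mem_closedBall_zero_iff.1 hz)
    rw [h, rootFun_param_sq (mem_closedBall_zero_iff.1 hz'), sub_right_inj,
      div_left_inj' hz0] at h1
    rw [h1]
  have hder : ∀ m ∈ L, deriv rootFun m ≠ 0 := by
    rintro _ ⟨z, hz, rfl⟩
    rcases eq_or_ne z critVal with rfl | hne
    · rw [param_critVal, deriv_rootFun_critPt, neg_ne_zero]
      exact rootFactor_ne_zero (hLD hcritL)
    · exact deriv_rootFun_ne_zero (norm_param_lt (mem_closedBall_zero_iff.1 hz) hne)
  obtain ⟨O, M, hO, hLO, hM, hMD, hleft, hMder⟩ := exists_analytic_inverse isOpen_paramDomain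
    differentiableOn_rootFun ((isCompact_closedBall _ _).image_of_continuousOn continuousOn_param)
    hLD hinj hder
  have h0 : rootFun critPt = 0 := by simp [rootFun]
  have ht := critPt_pos
  have hk : (0 : ℝ) < secondDiff critPt critPt := by
    unfold secondDiff
    positivity
  have hphi := phi_pos ht.le
  have hB : 0 < 1 + critPt + critPt ^ 2 := by positivity
  -- At the critical point, `rootFactor` is a positive real number.
  have hfac : rootFactor critPt = ((√(secondDiff critPt critPt) / ((1 + critPt ^ 2) *
      (1 + critPt + critPt ^ 2) * √(1 + critPt + critPt ^ 2)) : ℝ) : ℂ) := by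
    have hk' : secondDiff (critPt : ℂ) critPt = ((secondDiff critPt critPt : ℝ) : ℂ) := by
      unfold secondDiff
      push_cast
      rfl
    have hB' : 1 + (critPt : ℂ) + critPt ^ 2 = ((1 + critPt + critPt ^ 2 : ℝ) : ℂ) := by
      push_cast
      rfl
    rw [rootFactor, hk', hB', ofReal_cpow_half hk.le, ofReal_cpow_half hB.le]
    push_cast
    rfl
  refine ⟨O, M, (√(secondDiff critPt critPt) / ((1 + critPt ^ 2) *
      (1 + critPt + critPt ^ 2) * √(1 + critPt + critPt ^ 2)))⁻¹, hO, ?_, hM, hMD, ?_, ?_, ?_,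
      ?_, ?_⟩
  · refine Set.Subset.trans ?_ hLO
    rintro w ⟨hre, hw⟩
    have hz : ‖(critVal : ℂ) * (1 - w ^ 2)‖ ≤ critVal := by
      rw [norm_mul, Complex.norm_real, Real.norm_of_nonneg critVal_pos.le]
      exact mul_le_of_le_one_right critVal_pos.le hw
    refine ⟨_, ⟨_, mem_closedBall_zero_iff.2 hz, rfl⟩, ?_⟩
    rw [rootFun_param hz, mul_div_cancel_left₀ _ hz0, sub_sub_cancel]
    rcases hre.lt_or_eq with hre | hre
    · rw [one_div]
      exact Complex.sq_cpow_two_inv hre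
    · have h1 : w ^ 2 = ((-(w.im ^ 2) : ℝ) : ℂ) := by
        apply Complex.ext <;> simp [sq, ← hre]
      have h2 : w.im = 0 := by
        rw [h1, ← Complex.ofReal_one, ← Complex.ofReal_sub, Complex.norm_real, sub_neg_eq_add,
          Real.norm_of_nonneg (by positivity)] at hw
        have : w.im ^ 2 = 0 := le_antisymm (by linarith) (sq_nonneg _)
        exact pow_eq_zero_iff (two_ne_zero) |>.1 this
      have : w = 0 := Complex.ext (by simp [← hre]) (by simp [h2])
      simp [this]
  · rw [← h0]
    exact hleft _ hcritL
  · intro z hz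
    rw [← rootFun_param hz]
    exact hleft _ ⟨z, mem_closedBall_zero_iff.2 hz, rfl⟩
  · have := hMder _ hcritL
    rw [h0, deriv_rootFun_critPt, hfac] at this
    convert this using 1
    push_cast
    rw [inv_neg]
  · positivity
  · rw [inv_pow, div_pow, mul_pow, Real.sq_sqrt hk.le, Real.sq_sqrt hB.le, phi]
    field_simp

end PlaneTree

/-! ### Coefficients of holomorphic functions of the square root -/

/-- An integrable majorant of `‖1 - ρ exp (i θ)‖ ^ (-1 / 2)`, up to a constant factor. -/
noncomputable def circleMajorant (θ : ℝ) : ℝ :=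
  θ ^ (-(1 / 2) : ℝ) + (2 * Real.pi - θ) ^ (-(1 / 2) : ℝ)

theorem intervalIntegrable_circleMajorant :
    IntervalIntegrable circleMajorant MeasureTheory.volume 0 (2 * Real.pi) := by
  have h : ∀ a b : ℝ, IntervalIntegrable (fun x : ℝ => x ^ (-(1 / 2) : ℝ))
      MeasureTheory.volume a b := fun a b =>
    intervalIntegral.intervalIntegrable_rpow' (by norm_num)
  refine (h _ _).add ?_
  simpa using (h (2 * Real.pi) 0).comp_sub_left (2 * Real.pi)

theorem sin_half_le_norm_one_sub_circleMap {ρ : ℝ} (h0 : 0 ≤ ρ) {θ : ℝ}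
    (hθ : 0 ≤ θ) (hθ' : θ ≤ 2 * Real.pi) : Real.sin (θ / 2) ≤ ‖1 - circleMap 0 ρ θ‖ := by
  have hs : 0 ≤ Real.sin (θ / 2) := Real.sin_nonneg_of_nonneg_of_le_pi (by linarith) (by linarith)
  refine (sq_le_sq₀ hs (norm_nonneg _)).1 ?_
  have e : ‖1 - circleMap 0 ρ θ‖ ^ 2 = (1 - ρ) ^ 2 + 4 * ρ * Real.sin (θ / 2) ^ 2 := by
    have hc : Real.cos θ = 1 - 2 * Real.sin (θ / 2) ^ 2 := by
      have := Real.cos_sq' (θ / 2)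
      have h2 := Real.cos_two_mul (θ / 2)
      rw [mul_div_cancel₀ θ two_ne_zero] at h2
      rw [h2, this]
      ring
    rw [Complex.sq_norm, Complex.normSq_apply, circleMap_zero]
    simp only [Complex.sub_re, Complex.one_re, Complex.re_ofReal_mul, Complex.exp_ofReal_mul_I_re,
      Complex.sub_im, Complex.one_im, Complex.im_ofReal_mul, Complex.exp_ofReal_mul_I_im]
    have := Real.sin_sq_add_cos_sq θ
    have e2 : (1 - ρ * Real.cos θ) * (1 - ρ * Real.cos θ) +
        (0 - ρ * Real.sin θ) * (0 - ρ * Real.sin θ) = 1 - 2 * ρ * Real.cos θ + ρ ^ 2 := by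
      linear_combination ρ ^ 2 * this
    rw [e2, hc]
    ring
  rw [e]
  have h3 : Real.sin (θ / 2) ^ 2 ≤ 1 := by
    have := Real.sin_sq_add_cos_sq (θ / 2)
    nlinarith [sq_nonneg (Real.cos (θ / 2))]
  -- The right-hand side is at least `s² (1 - ρ)² + 4 ρ s² = s² (1 + ρ)²`.
  nlinarith [mul_nonneg (sq_nonneg (1 - ρ)) (sub_nonneg.2 h3), sq_nonneg (Real.sin (θ / 2)),
    mul_nonneg h0 (sq_nonneg (Real.sin (θ / 2))),
    mul_nonneg (mul_nonneg h0 h0) (sq_nonneg (Real.sin (θ / 2)))]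

theorem inv_sqrt_norm_le_circleMajorant {ρ : ℝ} (h0 : 0 ≤ ρ) {θ : ℝ}
    (hθ : 0 < θ) (hθ' : θ < 2 * Real.pi) :
    (√‖1 - circleMap 0 ρ θ‖)⁻¹ ≤ √Real.pi * circleMajorant θ := by
  have hpi := Real.pi_pos
  have key : ∀ x : ℝ, 0 < x → x / Real.pi ≤ ‖1 - circleMap 0 ρ θ‖ →
      (√‖1 - circleMap 0 ρ θ‖)⁻¹ ≤ √Real.pi * x ^ (-(1 / 2) : ℝ) := by
    intro x hx h
    have e : √Real.pi * x ^ (-(1 / 2) : ℝ) = (√(x / Real.pi))⁻¹ := by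
      rw [Real.rpow_neg hx.le, ← Real.sqrt_eq_rpow, Real.sqrt_div hx.le, inv_div]
      rfl
    rw [e]
    have : 0 < √(x / Real.pi) := Real.sqrt_pos.2 (by positivity)
    gcongr
  have hn1 : 0 ≤ θ ^ (-(1 / 2) : ℝ) := Real.rpow_nonneg hθ.le _
  have hn2 : 0 ≤ (2 * Real.pi - θ) ^ (-(1 / 2) : ℝ) := Real.rpow_nonneg (by linarith) _
  have hs := sin_half_le_norm_one_sub_circleMap h0 hθ.le hθ'.le
  rw [circleMajorant, mul_add]
  rcases le_total θ Real.pi with h | h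
  · refine (key θ hθ (le_trans ?_ hs)).trans (le_add_of_nonneg_right (by positivity))
    refine le_trans (le_of_eq ?_) (Real.mul_le_sin (x := θ / 2) (by linarith) (by linarith))
    ring
  · refine (key (2 * Real.pi - θ) (by linarith) (le_trans ?_ hs)).trans
      (le_add_of_nonneg_left (by positivity))
    have := Real.mul_le_sin (x := Real.pi - θ / 2) (by linarith) (by linarith)
    rw [Real.sin_pi_sub] at this
    refine le_trans (le_of_eq ?_) this
    ring

/-- Cauchy estimate for a function that grows at most like `‖1 - u‖ ^ (-1 / 2)` in the unit disc:
the singularity is integrable, so the Taylor coefficients are bounded. -/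
theorem exists_norm_iteratedDeriv_le {f : ℂ → ℂ} (hf : DifferentiableOn ℂ f (Metric.ball 0 1))
    {C : ℝ} (hC : ∀ u : ℂ, ‖u‖ < 1 → ‖f u‖ ≤ C * (√‖1 - u‖)⁻¹) :
    ∃ C', ∀ k : ℕ, ‖iteratedDeriv k f 0‖ ≤ C' * k.factorial := by
  have hC0 : 0 ≤ C := by
    have := (norm_nonneg _).trans (hC 0 (by simp))
    simpa using this
  set I := ∫ θ in (0 : ℝ)..2 * Real.pi, C * (√Real.pi * circleMajorant θ) with hI
  refine ⟨I / (2 * Real.pi), fun k => ?_⟩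
  have hpi := Real.pi_pos
  have hfac : (0 : ℝ) < k.factorial := by exact_mod_cast k.factorial_pos
  have main : ∀ ρ : ℝ, 0 < ρ → ρ < 1 →
      ρ ^ k * ‖iteratedDeriv k f 0‖ ≤ I / (2 * Real.pi) * k.factorial := by
    intro ρ h0 h1
    have hcl : Metric.closedBall (0 : ℂ) ρ ⊆ Metric.ball 0 1 := Metric.closedBall_subset_ball h1
    have hcauchy := (hf.mono hcl).circleIntegral_one_div_sub_center_pow_smul h0 k
    have hbound : ‖∮ z in C(0, ρ), (1 / (z - 0) ^ (k + 1)) • f z‖ ≤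
        ∫ θ in (0 : ℝ)..2 * Real.pi, (ρ ^ k)⁻¹ * (C * (√Real.pi * circleMajorant θ)) := by
      refine intervalIntegral.norm_integral_le_of_norm_le (by positivity) ?_
        (((intervalIntegrable_circleMajorant.const_mul _).const_mul _).const_mul _)
      have hae : ∀ᵐ θ : ℝ, θ ≠ 2 * Real.pi := by
        simp [MeasureTheory.ae_iff]
      filter_upwards [hae] with θ hθ hmem
      have hθ2 : θ < 2 * Real.pi := lt_of_le_of_ne hmem.2 hθ
      have hn : ‖circleMap 0 ρ θ‖ = ρ := by simp [abs_of_pos h0]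
      have hfu := hC (circleMap 0 ρ θ) (by rw [hn]; exact h1)
      have hm := inv_sqrt_norm_le_circleMajorant h0.le hmem.1 hθ2
      rw [sub_zero, norm_smul, norm_smul, deriv_circleMap, norm_mul, Complex.norm_I, mul_one,
        norm_div, norm_one, norm_pow, hn]
      have e : ρ * (1 / ρ ^ (k + 1) * ‖f (circleMap 0 ρ θ)‖) =
          (ρ ^ k)⁻¹ * ‖f (circleMap 0 ρ θ)‖ := by
        field_simp
        ring
      rw [e]
      gcongr
      exact hfu.trans (by gcongr)
    rw [hcauchy, norm_smul, intervalIntegral.integral_const_mul, ← hI, norm_div, norm_mul,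
      norm_mul, Complex.norm_I, Complex.norm_natCast, Complex.norm_real, Complex.norm_ofNat,
      Real.norm_of_nonneg hpi.le, mul_one] at hbound
    have hρk : 0 < ρ ^ k := by positivity
    rw [div_mul_eq_mul_div, div_le_iff₀ hfac, inv_mul_eq_div, div_mul_eq_mul_div,
      le_div_iff₀ hρk] at hbound
    rw [div_mul_eq_mul_div, le_div_iff₀ (by positivity)]
    linarith
  have hlim : Tendsto (fun ρ : ℝ => ρ ^ k * ‖iteratedDeriv k f 0‖) (𝓝[<] 1)
      (𝓝 (1 ^ k * ‖iteratedDeriv k f 0‖)) :=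
    (Continuous.tendsto (by fun_prop) (1 : ℝ)).mono_left nhdsWithin_le_nhds
  rw [one_pow, one_mul] at hlim
  refine le_of_tendsto hlim ?_
  filter_upwards [Ioo_mem_nhdsLT (zero_lt_one (α := ℝ))] with ρ hρ
  exact main ρ hρ.1 hρ.2

theorem cpow_half_mem_sqrtDisc {u : ℂ} (hu : ‖u‖ ≤ 1) : (1 - u) ^ (1 / 2 : ℂ) ∈ sqrtDisc :=
  ⟨cpow_half_re_nonneg _, by rwa [sq_cpow_half, sub_sub_cancel]⟩

theorem one_sub_mem_slitPlane {u : ℂ} (hu : ‖u‖ < 1) : 1 - u ∈ Complex.slitPlane := by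
  refine Or.inl ?_
  rw [Complex.sub_re, Complex.one_re, sub_pos]
  exact (Complex.re_le_norm u).trans_lt hu

theorem hasDerivAt_cpow_half_one_sub {u : ℂ} (hu : ‖u‖ < 1) :
    HasDerivAt (fun u : ℂ => (1 - u) ^ (1 / 2 : ℂ)) (-(2 * (1 - u) ^ (1 / 2 : ℂ))⁻¹) u := by
  have hs := one_sub_mem_slitPlane hu
  have h1 : HasDerivAt (fun u : ℂ => 1 - u) (-1) u := by simpa using (hasDerivAt_id' u).const_sub 1
  have h2 := h1.cpow_const (c := 1 / 2) hs
  refine h2.congr_deriv ?_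
  have h0 : (1 - u) ≠ 0 := Complex.slitPlane_ne_zero hs
  have h3 := cpow_half_ne_zero h0
  rw [Complex.cpow_sub _ _ h0, Complex.cpow_one]
  have h4 := sq_cpow_half (1 - u)
  field_simp
  linear_combination -h4

/-- If `F` is holomorphic near the values of `√(1 - u)` and `F'(0) = 0`, then the second derivative
of `F (√(1 - u))` is `O(‖1 - u‖ ^ (-1 / 2))`, so that its Taylor coefficients are `O(n ^ (-2))`. -/
theorem exists_coeff_bound_of_sqrt {F : ℂ → ℂ} {O : Set ℂ} (hO : IsOpen O) (hK : sqrtDisc ⊆ O)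
    (hF : DifferentiableOn ℂ F O) (hd : deriv F 0 = 0) {b : ℕ → ℂ}
    (hsum : ∀ u : ℂ, ‖u‖ < 1 → HasSum (fun n => b n * u ^ n) (F ((1 - u) ^ (1 / 2 : ℂ)))) :
    ∃ C, ∀ k : ℕ, ‖b (k + 2)‖ * ((k + 2) * (k + 1)) ≤ C := by
  have h0O : (0 : ℂ) ∈ O := hK ⟨by simp, by simp⟩
  have hF' : DifferentiableOn ℂ (deriv F) O := hF.deriv hO
  set R : ℂ → ℂ := dslope (deriv F) 0 with hR
  have hRd : DifferentiableOn ℂ R O :=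
    (Complex.differentiableOn_dslope (hO.mem_nhds h0O)).2 hF'
  have hR' : DifferentiableOn ℂ (deriv R) O := hRd.deriv hO
  set D : ℂ → ℂ := fun u => F ((1 - u) ^ (1 / 2 : ℂ)) with hD
  have hOmem : ∀ {u : ℂ}, ‖u‖ < 1 → (1 - u) ^ (1 / 2 : ℂ) ∈ O := fun hu =>
    hK (cpow_half_mem_sqrtDisc hu.le)
  have hne : ∀ {u : ℂ}, ‖u‖ < 1 → (1 - u) ^ (1 / 2 : ℂ) ≠ 0 := fun hu =>
    cpow_half_ne_zero (Complex.slitPlane_ne_zero (one_sub_mem_slitPlane hu))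
  have hD1 : ∀ {u : ℂ}, ‖u‖ < 1 → HasDerivAt D (-(1 / 2) * R ((1 - u) ^ (1 / 2 : ℂ))) u := by
    intro u hu
    have h1 := (hF.differentiableAt (hO.mem_nhds (hOmem hu))).hasDerivAt.comp u
      (hasDerivAt_cpow_half_one_sub hu)
    refine h1.congr_deriv ?_
    rw [hR, dslope_of_ne _ (hne hu), slope_def_field, hd]
    have := hne hu
    field_simp
    ring
  have hball : Metric.ball (0 : ℂ) 1 ∈ 𝓝 (0 : ℂ) := Metric.ball_mem_nhds _ one_pos
  have hev : ∀ {u : ℂ}, ‖u‖ < 1 → ∀ᶠ v in 𝓝 u, ‖v‖ < 1 := fun hu =>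
    (isOpen_lt continuous_norm continuous_const).mem_nhds hu
  have hD2 : ∀ {u : ℂ}, ‖u‖ < 1 → HasDerivAt (deriv D)
      (-(1 / 2) * (deriv R ((1 - u) ^ (1 / 2 : ℂ)) * -(2 * (1 - u) ^ (1 / 2 : ℂ))⁻¹)) u := by
    intro u hu
    have h1 := (hRd.differentiableAt (hO.mem_nhds (hOmem hu))).hasDerivAt.comp u
      (hasDerivAt_cpow_half_one_sub hu)
    refine (h1.const_mul (-(1 / 2) : ℂ)).congr_of_eventuallyEq ?_
    filter_upwards [hev hu] with v hv
    exact (hD1 hv).deriv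
  obtain ⟨C, hC⟩ := isCompact_sqrtDisc.exists_bound_of_continuousOn (hR'.continuousOn.mono hK)
  have hdd : DifferentiableOn ℂ (deriv (deriv D)) (Metric.ball 0 1) := by
    refine DifferentiableOn.deriv (fun u hu => ?_) Metric.isOpen_ball
    exact (hD2 (mem_ball_zero_iff.1 hu)).differentiableAt.differentiableWithinAt
  have hbound : ∀ u : ℂ, ‖u‖ < 1 → ‖deriv (deriv D) u‖ ≤ (C / 4) * (√‖1 - u‖)⁻¹ := by
    intro u hu
    rw [(hD2 hu).deriv, ← norm_sq_cpow_half (1 - u), Real.sqrt_sq (norm_nonneg _)]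
    have h1 := hC _ (cpow_half_mem_sqrtDisc hu.le)
    simp only [norm_mul, norm_neg, norm_inv, norm_div, norm_one, Complex.norm_ofNat, mul_inv]
    calc 1 / 2 * (‖deriv R ((1 - u) ^ (1 / 2 : ℂ))‖ * (2⁻¹ * ‖(1 - u) ^ (1 / 2 : ℂ)‖⁻¹))
        = ‖deriv R ((1 - u) ^ (1 / 2 : ℂ))‖ / 4 * ‖(1 - u) ^ (1 / 2 : ℂ)‖⁻¹ := by ring
      _ ≤ C / 4 * ‖(1 - u) ^ (1 / 2 : ℂ)‖⁻¹ := by gcongr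
  obtain ⟨C', hC'⟩ := exists_norm_iteratedDeriv_le hdd hbound
  have hDan : AnalyticAt ℂ D 0 := by
    refine DifferentiableOn.analyticAt (s := Metric.ball 0 1) (fun u hu => ?_) hball
    exact (hD1 (mem_ball_zero_iff.1 hu)).differentiableAt.differentiableWithinAt
  have hps : HasFPowerSeriesAt D (FormalMultilinearSeries.ofScalars ℂ b) 0 := by
    refine hasFPowerSeriesAt_iff.2 ?_
    filter_upwards [hball] with u hu
    simpa [mul_comm, hD] using hsum u (mem_ball_zero_iff.1 hu)
  have hcoeff : ∀ n, b n = iteratedDeriv n D 0 / n.factorial := by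
    have := hps.eq_formalMultilinearSeries hDan.hasFPowerSeriesAt
    intro n
    have h1 := congrArg (fun p => FormalMultilinearSeries.coeff p n) this
    simpa using h1
  refine ⟨C', fun k => ?_⟩
  have h1 := hC' k
  have hfac : (0 : ℝ) < k.factorial := by exact_mod_cast k.factorial_pos
  rw [hcoeff, iteratedDeriv_succ', iteratedDeriv_succ', norm_div, Complex.norm_natCast,
    Nat.factorial_succ, Nat.factorial_succ]
  push_cast
  rw [← div_le_iff₀ hfac] at h1
  refine le_trans (le_of_eq ?_) h1
  field_simp
  ring

/-! ### The number of plane trees -/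

namespace PlaneTree

theorem card_treesOfSize_zero : (treesOfSize 0).card = 0 := by
  rw [Finset.card_eq_zero, Finset.eq_empty_iff_forall_notMem]
  intro T hT
  exact (size_pos T).ne' (mem_treesOfSize.1 hT)

theorem card_treesOfSize_eq (n : ℕ) : (treesOfSize n).card = (if n = 1 then 1 else 0) +
    ∑ p ∈ Finset.HasAntidiagonal.antidiagonal n,
      (treesOfSize p.1).card * (treesOfSize p.2).card := by
  have := sum_treesOfSize (fun _ => 1) n
  simpa using this

theorem card_treesOfSize_succ (n : ℕ) : (treesOfSize (n + 1)).card = catalan n := by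
  induction n using Nat.strong_induction_on with
  | _ n ih =>
    rw [card_treesOfSize_eq]
    rcases n with _ | n
    · simp [Finset.Nat.antidiagonal_succ, card_treesOfSize_zero]
    · rw [Finset.Nat.antidiagonal_succ_succ', catalan_succ', if_neg (by omega)]
      simp only [Finset.sum_cons, card_treesOfSize_zero, zero_mul, mul_zero, zero_add,
        Finset.sum_map]
      refine Finset.sum_congr rfl fun p hp => ?_
      rw [Finset.HasAntidiagonal.mem_antidiagonal] at hp
      exact congrArg₂ _ (ih p.1 (by omega)) (ih p.2 (by omega))

theorem sixteen_pow_le (k : ℕ) (hk : 1 ≤ k) : 16 ^ k ≤ k.centralBinom ^ 2 * (4 * k) := by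
  induction k, hk using Nat.le_induction with
  | base => decide
  | succ k hk ih =>
    have h := Nat.succ_mul_centralBinom_succ k
    refine Nat.le_of_mul_le_mul_left ?_ (show 0 < (k + 1) ^ 2 * k by positivity)
    calc (k + 1) ^ 2 * k * 16 ^ (k + 1) = 16 * (k + 1) ^ 2 * k * 16 ^ k := by ring
      _ ≤ 16 * (k + 1) ^ 2 * k * (k.centralBinom ^ 2 * (4 * k)) := by gcongr
      _ = 4 * (k + 1) * k * (4 * (k * (k + 1))) * (4 * k.centralBinom ^ 2) := by ring
      _ ≤ 4 * (k + 1) * k * (2 * k + 1) ^ 2 * (4 * k.centralBinom ^ 2) := by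
        gcongr
        nlinarith
      _ = (2 * (2 * k + 1) * k.centralBinom) ^ 2 * (4 * (k + 1)) * k := by ring
      _ = (k + 1) ^ 2 * k * ((k + 1).centralBinom ^ 2 * (4 * (k + 1))) := by
        rw [← h]
        ring

/-- The number of plane trees grows faster than `4 ^ n / n ^ 2`. -/
theorem sqrt_mul_four_pow_le (k : ℕ) :
    √k * 4 ^ k ≤ 2 * (k * ((k + 1) * (treesOfSize (k + 1)).card)) := by
  rcases Nat.eq_zero_or_pos k with rfl | hk
  · simp
  have h1 : ((k + 1) * (treesOfSize (k + 1)).card : ℝ) = k.centralBinom := by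
    rw [card_treesOfSize_succ]
    exact_mod_cast succ_mul_catalan_eq_centralBinom k
  have h2 : (16 : ℝ) ^ k ≤ k.centralBinom ^ 2 * (4 * k) := by exact_mod_cast sixteen_pow_le k hk
  rw [h1]
  refine abs_le_of_sq_le_sq' ?_ (by positivity) |>.2
  rw [mul_pow, Real.sq_sqrt (Nat.cast_nonneg k), ← pow_mul, mul_comm k 2, pow_mul]
  have hk' : (0 : ℝ) < k := by exact_mod_cast hk
  norm_num
  nlinarith

theorem hasSum_sizes {w : PlaneTree → ℕ} {z s : ℂ}
    (h : HasSum (fun T : PlaneTree => (w T : ℂ) * z ^ T.size) s) :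
    HasSum (fun n => ((∑ T ∈ treesOfSize n, w T : ℕ) : ℂ) * z ^ n) s := by
  refine (h.tsum_fiberwise size).congr_fun fun n => ?_
  have hset : size ⁻¹' {n} = (treesOfSize n : Set PlaneTree) := by
    ext T
    simp [mem_treesOfSize]
  rw [hset, Finset.tsum_subtype' (treesOfSize n) fun T => (w T : ℂ) * z ^ T.size]
  push_cast
  rw [Finset.sum_mul]
  exact Finset.sum_congr rfl fun T hT => by rw [mem_treesOfSize.1 hT]

theorem summable_one_and_le : Summable (fun T => (((fun _ => 1 : PlaneTree → ℕ) T : ℕ) : ℝ)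
      * (1 / 4) ^ T.size) ∧
    ∑' T, (((fun _ => 1 : PlaneTree → ℕ) T : ℕ) : ℝ) * (1 / 4) ^ T.size ≤ 1 / 2 := by
  refine summable_of_partialGF_le (by norm_num) fun n => ?_
  induction n with
  | zero => simp [partialGF, treesUpTo_zero]
  | succ n ih =>
    have h1 := partialGF_succ_le (f := fun _ => 1) (a := fun _ => 1) (b := fun _ => 1)
      (c := fun _ => 0) (d := fun _ => 0) rfl (by simp) (x := 1 / 4) (by norm_num) n
    have h2 : partialGF (fun _ => 0) (1 / 4) n = 0 := by simp [partialGF]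
    rw [h2, mul_zero, add_zero] at h1
    have h3 := partialGF_nonneg (fun _ => 1) (x := 1 / 4) (by norm_num) n
    refine h1.trans ?_
    nlinarith

/-- The generating function of the plane trees themselves. -/
theorem hasSum_card_treesOfSize {z : ℂ} (hz : ‖z‖ < 1 / 4) :
    HasSum (fun n => ((treesOfSize n).card : ℂ) * z ^ n)
      ((1 - (1 - 4 * z) ^ (1 / 2 : ℂ)) / 2) := by
  have hzero : Summable fun T : PlaneTree => (((fun _ => 0 : PlaneTree → ℕ) T : ℕ) : ℝ)
      * (1 / 4) ^ T.size := by simp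
  have h1 := gf_eq_of_mul_add_mul (f := fun _ => 1) (a := fun _ => 1) (b := fun _ => 1)
    (c := fun _ => 0) (d := fun _ => 0) rfl (by simp) summable_one_and_le.1 summable_one_and_le.1
    hzero hzero hz.le
  have h2 : gf (fun _ => 0) z = 0 := by simp [gf]
  rw [h2, mul_zero, add_zero] at h1
  have h3 := (norm_gf_le summable_one_and_le.1 hz.le).trans summable_one_and_le.2
  have h4 := hasSum_sizes (hasSum_gf summable_one_and_le.1 hz.le)
  generalize gf (fun _ => 1) z = g at h1 h3 h4
  have h5 : (1 - 2 * g) ^ 2 = 1 - 4 * z := by linear_combination -4 * h1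
  have hre : 0 ≤ (1 - 2 * g).re := by
    have := (Complex.re_le_norm g).trans h3
    simp
    linarith
  have hre' : (1 - 2 * g).re ≠ 0 := by
    intro h0
    have h6 := congrArg Complex.re h5
    rw [sq, Complex.mul_re, h0] at h6
    have h7 := Complex.re_le_norm z
    simp at h6
    nlinarith [mul_self_nonneg g.im]
  have h8 : 1 - 2 * g = (1 - 4 * z) ^ (1 / 2 : ℂ) := by
    rw [← h5, one_div]
    exact (Complex.sq_cpow_two_inv (lt_of_le_of_ne hre hre'.symm)).symm
  have h9 : (1 - (1 - 4 * z) ^ (1 / 2 : ℂ)) / 2 = g := by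
    rw [← h8]
    ring
  rw [h9]
  simpa using h4

/-! ### The asymptotics of the expectation -/

/-- Transfer of the dominant square-root singularity at `z₀` to the coefficients, relative to the
generating function `(1 - √(1 - 4 z)) / 2` of the plane trees. -/
theorem expectation_isEquivalent {w : PlaneTree → ℕ} {z₀ B : ℝ} (h0 : 0 < z₀) (hB : B ≠ 0)
    {F : ℂ → ℂ} {O : Set ℂ} (hO : IsOpen O) (hK : sqrtDisc ⊆ O) (hF : DifferentiableOn ℂ F O)
    (hd : deriv F 0 = -B)
    (hsum : ∀ z : ℂ, ‖z‖ < z₀ → HasSum (fun T : PlaneTree => (w T : ℂ) * z ^ T.size)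
      (F ((1 - z / z₀) ^ (1 / 2 : ℂ)))) :
    (fun n : ℕ => expectation (fun T => (w T : ℝ)) n) ~[atTop]
      fun n : ℕ => 2 * B * (1 / (4 * z₀)) ^ n := by
  have h0' : (z₀ : ℂ) ≠ 0 := by exact_mod_cast h0.ne'
  have h0O : (0 : ℂ) ∈ O := hK ⟨by simp, by simp⟩
  -- Subtracting a multiple of the tree generating function cancels the square-root term.
  set b : ℕ → ℂ := fun n => ((∑ T ∈ treesOfSize n, w T : ℕ) : ℂ) * (z₀ : ℂ) ^ n -
    2 * B * ((treesOfSize n).card * (1 / 4 : ℂ) ^ n) with hb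
  obtain ⟨C, hC⟩ := exists_coeff_bound_of_sqrt (F := fun s => F s - B * (1 - s)) (b := b) hO hK
    (hF.sub (by fun_prop)) (by
      have h1 := (hF.differentiableAt (hO.mem_nhds h0O)).hasDerivAt
      have h2 : HasDerivAt (fun s : ℂ => (B : ℂ) * (1 - s)) (B * -1) 0 := by
        simpa using ((hasDerivAt_id' (0 : ℂ)).const_sub 1).const_mul (B : ℂ)
      have h3 := (h1.fun_sub h2).deriv
      rw [h3, hd]
      ring) (by
    intro u hu
    have hu1 : ‖u * z₀‖ < z₀ := by
      rw [norm_mul, Complex.norm_real, Real.norm_of_nonneg h0.le]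
      nlinarith
    have hu2 : ‖u / 4‖ < 1 / 4 := by
      rw [norm_div, Complex.norm_ofNat]
      linarith
    have s1 := hasSum_sizes (hsum _ hu1)
    have s2 := (hasSum_card_treesOfSize hu2).mul_left (2 * (B : ℂ))
    rw [mul_div_cancel_right₀ _ h0'] at s1
    rw [mul_div_cancel₀ u (by norm_num : (4 : ℂ) ≠ 0)] at s2
    have s3 := s1.sub s2
    have e : 2 * (B : ℂ) * ((1 - (1 - u) ^ (1 / 2 : ℂ)) / 2) =
        B * (1 - (1 - u) ^ (1 / 2 : ℂ)) := by ring
    rw [e] at s3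
    refine s3.congr_fun fun n => ?_
    rw [hb, mul_pow, div_pow]
    simp only [one_div, inv_pow]
    ring)
  have hC0 : 0 ≤ C := le_trans (by positivity) (hC 0)
  refine isEquivalent_of_tendsto_one ?_
  have hlim : Tendsto (fun n : ℕ => expectation (fun T => (w T : ℝ)) n /
      (2 * B * (1 / (4 * z₀)) ^ n) - 1) atTop (𝓝 0) := by
    rw [← tendsto_add_atTop_iff_nat 2]
    have hbd : ∀ k : ℕ, ‖expectation (fun T => (w T : ℝ)) (k + 2) /
        (2 * B * (1 / (4 * z₀)) ^ (k + 2)) - 1‖ ≤ (4 * C / |B|) / √((k + 1 : ℕ) : ℝ) := by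
      intro k
      have ht := sqrt_mul_four_pow_le (k + 1)
      have hs : 0 < √((k + 1 : ℕ) : ℝ) := Real.sqrt_pos.2 (by positivity)
      have hk := hC k
      set t : ℝ := ((treesOfSize (k + 1 + 1)).card : ℝ) with htdef
      have htpos : 0 < t := by
        have h1 : 0 < √((k + 1 : ℕ) : ℝ) * 4 ^ (k + 1) := by positivity
        by_contra! hneg
        have h2 : t = 0 := le_antisymm hneg (Nat.cast_nonneg _)
        rw [h2] at ht
        simp only [mul_zero] at ht
        linarith
      have hB' : 0 < |B| := abs_pos.2 hB
      have hbn : b (k + 2) = ((((∑ T ∈ treesOfSize (k + 2), (w T : ℝ)) * z₀ ^ (k + 2) -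
          2 * B * (t * (1 / 4) ^ (k + 2))) : ℝ) : ℂ) := by
        rw [hb, htdef]
        push_cast
        rfl
      rw [hbn, Complex.norm_real] at hk
      have e : expectation (fun T => (w T : ℝ)) (k + 2) /
          (2 * B * (1 / (4 * z₀)) ^ (k + 2)) - 1 =
          ((∑ T ∈ treesOfSize (k + 2), (w T : ℝ)) * z₀ ^ (k + 2) -
          2 * B * (t * (1 / 4) ^ (k + 2))) * (4 ^ (k + 2) / (2 * B * t)) := by
        rw [expectation]
        change _ / t / _ - 1 = _
        rw [one_div_pow, one_div_pow, mul_pow]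
        field_simp
      rw [e, norm_mul, Real.norm_eq_abs (4 ^ (k + 2) / (2 * B * t)), abs_div, abs_mul, abs_mul,
        abs_of_pos htpos, abs_of_pos (by positivity : (0 : ℝ) < 4 ^ (k + 2)),
        abs_of_pos (by norm_num : (0 : ℝ) < 2)]
      have hβ0 := norm_nonneg ((∑ T ∈ treesOfSize (k + 2), (w T : ℝ)) * z₀ ^ (k + 2) -
          2 * B * (t * (1 / 4) ^ (k + 2)))
      generalize ‖(∑ T ∈ treesOfSize (k + 2), (w T : ℝ)) * z₀ ^ (k + 2) -
          2 * B * (t * (1 / 4) ^ (k + 2))‖ = β at hk hβ0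
      rw [mul_div_assoc', div_div, div_le_div_iff₀ (by positivity) (by positivity)]
      push_cast at ht ⊢
      calc β * 4 ^ (k + 2) * (|B| * √(k + 1)) = 4 * |B| * β * (√(k + 1) * 4 ^ (k + 1)) := by ring
        _ ≤ 4 * |B| * β * (2 * ((k + 1) * ((k + 1 + 1) * t))) := by gcongr
        _ = 8 * |B| * t * (β * ((k + 2) * (k + 1))) := by ring
        _ ≤ 8 * |B| * t * C := by gcongr
        _ = 4 * C * (2 * |B| * t) := by ring
    refine squeeze_zero_norm hbd ?_
    refine Tendsto.div_atTop tendsto_const_nhds ?_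
    exact Real.tendsto_sqrt_atTop.comp
      (tendsto_natCast_atTop_atTop.comp (tendsto_add_atTop_nat 1))
  simpa [Pi.div_def] using hlim.add_const 1

/-! ### Numerical values -/

/-- The derivative of `paramS`. -/
def paramSDeriv {K : Type*} [Field K] (m : K) : K :=
  (1 - 2 * m ^ 2 - 2 * m ^ 3 - 3 * m ^ 4) / ((1 + m ^ 2) * (1 + m + m ^ 2)) ^ 2

/-- The derivative of `paramP`. -/
def paramPDeriv {K : Type*} [Field K] (m : K) : K :=
  2 * (1 + 3 * m + 2 * m ^ 2 + 3 * m ^ 3) / ((1 + m ^ 2) ^ 2 * (1 + m + m ^ 2) ^ 3)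

theorem hasDerivAt_paramS {m : ℂ} (hm : m ∈ paramDomain) :
    HasDerivAt paramS (paramSDeriv m) m := by
  have hA := hm.2.2
  have hB := ne_zero_of_re_pos hm.2.1
  have h1 : HasDerivAt (fun m : ℂ => 1 + m ^ 2) (2 * m) m := by
    simpa using (hasDerivAt_pow 2 m).const_add 1
  have h2 : HasDerivAt (fun m : ℂ => 1 + m + m ^ 2) (1 + 2 * m) m := by
    simpa using ((hasDerivAt_id' m).const_add 1).fun_add (hasDerivAt_pow 2 m)
  refine ((hasDerivAt_id' m).fun_div (h1.fun_mul h2) (mul_ne_zero hA hB)).congr_deriv ?_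
  rw [paramSDeriv]
  congr 1
  ring

theorem hasDerivAt_paramP {m : ℂ} (hm : m ∈ paramDomain) :
    HasDerivAt paramP (paramPDeriv m) m := by
  have hA := hm.2.2
  have hB := ne_zero_of_re_pos hm.2.1
  have h1 : HasDerivAt (fun m : ℂ => 1 + m ^ 2) (2 * m) m := by
    simpa using (hasDerivAt_pow 2 m).const_add 1
  have h2 : HasDerivAt (fun m : ℂ => 1 + m + m ^ 2) (1 + 2 * m) m := by
    simpa using ((hasDerivAt_id' m).const_add 1).fun_add (hasDerivAt_pow 2 m)
  have h3 := ((hasDerivAt_const m (1 : ℂ)).fun_div (h1.fun_mul (h2.fun_pow 2))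
    (mul_ne_zero hA (pow_ne_zero 2 hB))).const_sub 1
  refine h3.congr_deriv ?_
  rw [paramPDeriv]
  push_cast
  field_simp
  ring

theorem critVal_bounds : |critVal - 0.0982673| ≤ 0.00000005 ∧
    |1 / (4 * critVal) - 2.54408| ≤ 0.000005 := by
  have hl := lt_critPt.le
  have hu := critPt_lt.le
  have h0 := critPt_pos
  have h1 : critVal ≤ 0.232617924 /
      ((1 + 0.232617923 ^ 2) ^ 2 * (1 + 0.232617923 + 0.232617923 ^ 2) ^ 3) := by
    unfold critVal phi
    gcongr
  have h2 : 0.232617923 / ((1 + 0.232617924 ^ 2) ^ 2 * (1 + 0.232617924 + 0.232617924 ^ 2) ^ 3) ≤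
      critVal := by
    unfold critVal phi
    gcongr
  have h3 : critVal ≤ 0.09826733 := h1.trans (by norm_num)
  have h4 : 0.09826731 ≤ critVal := le_trans (by norm_num) h2
  have hv := critVal_pos
  refine ⟨abs_le.2 ⟨by linarith, by linarith⟩, abs_le.2 ⟨?_, ?_⟩⟩
  · rw [le_sub_iff_add_le, le_div_iff₀ (by positivity)]
    linarith
  · rw [sub_le_iff_le_add, div_le_iff₀ (by positivity)]
    linarith

theorem paramS_critPt_bounds : |paramS critPt - 0.171502| ≤ 0.0000005 := by
  have hl := lt_critPt.le
  have hu := critPt_lt.le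
  have h0 := critPt_pos
  have h1 : paramS critPt ≤ 0.232617924 /
      ((1 + 0.232617923 ^ 2) * (1 + 0.232617923 + 0.232617923 ^ 2)) := by
    unfold paramS
    gcongr
  have h2 : 0.232617923 / ((1 + 0.232617924 ^ 2) * (1 + 0.232617924 + 0.232617924 ^ 2)) ≤
      paramS critPt := by
    unfold paramS
    gcongr
  exact abs_le.2 ⟨by linarith [le_trans (by norm_num : (0.1715019 : ℝ) ≤ _) h2],
    by linarith [h1.trans (by norm_num : _ ≤ (0.1715023 : ℝ))]⟩

theorem paramP_critPt_bounds : |paramP critPt - 0.427020| ≤ 0.0000005 := by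
  have hl := lt_critPt.le
  have hu := critPt_lt.le
  have h0 := critPt_pos
  have h1 : paramP critPt ≤
      1 - 1 / ((1 + 0.232617924 ^ 2) * (1 + 0.232617924 + 0.232617924 ^ 2) ^ 2) := by
    unfold paramP
    gcongr
  have h2 : 1 - 1 / ((1 + 0.232617923 ^ 2) * (1 + 0.232617923 + 0.232617923 ^ 2) ^ 2) ≤
      paramP critPt := by
    unfold paramP
    gcongr
  exact abs_le.2 ⟨by linarith [le_trans (by norm_num : (0.4270199 : ℝ) ≤ _) h2],
    by linarith [h1.trans (by norm_num : _ ≤ (0.4270202 : ℝ))]⟩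

theorem paramSDeriv_critPt_bounds :
    0.46628221 ≤ paramSDeriv critPt ∧ paramSDeriv critPt ≤ 0.46628227 := by
  have hl := lt_critPt.le
  have hu := critPt_lt.le
  have h0 := critPt_pos
  have h1 : paramSDeriv critPt ≤
      (1 - 2 * 0.232617923 ^ 2 - 2 * 0.232617923 ^ 3 - 3 * 0.232617923 ^ 4) /
      ((1 + 0.232617923 ^ 2) * (1 + 0.232617923 + 0.232617923 ^ 2)) ^ 2 := by
    unfold paramSDeriv
    refine div_le_div₀ (by norm_num) (by gcongr) (by norm_num) (by gcongr)
  have h2 : (1 - 2 * 0.232617924 ^ 2 - 2 * 0.232617924 ^ 3 - 3 * 0.232617924 ^ 4) /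
      ((1 + 0.232617924 ^ 2) * (1 + 0.232617924 + 0.232617924 ^ 2)) ^ 2 ≤ paramSDeriv critPt := by
    unfold paramSDeriv
    have h3 : (1 - 2 * 0.232617924 ^ 2 - 2 * 0.232617924 ^ 3 - 3 * 0.232617924 ^ 4) ≤
      1 - 2 * critPt ^ 2 - 2 * critPt ^ 3 - 3 * critPt ^ 4 := by gcongr
    refine div_le_div₀ (le_trans (by norm_num) h3) h3 (by positivity) (by gcongr)
  exact ⟨le_trans (by norm_num) h2, h1.trans (by norm_num)⟩

theorem paramPDeriv_critPt_bounds :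
    1.55782473 ≤ paramPDeriv critPt ∧ paramPDeriv critPt ≤ 1.55782479 := by
  have hl := lt_critPt.le
  have hu := critPt_lt.le
  have h0 := critPt_pos
  have h1 : paramPDeriv critPt ≤
      2 * (1 + 3 * 0.232617924 + 2 * 0.232617924 ^ 2 + 3 * 0.232617924 ^ 3) /
      ((1 + 0.232617923 ^ 2) ^ 2 * (1 + 0.232617923 + 0.232617923 ^ 2) ^ 3) := by
    unfold paramPDeriv
    gcongr
  have h2 : 2 * (1 + 3 * 0.232617923 + 2 * 0.232617923 ^ 2 + 3 * 0.232617923 ^ 3) /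
      ((1 + 0.232617924 ^ 2) ^ 2 * (1 + 0.232617924 + 0.232617924 ^ 2) ^ 3) ≤
      paramPDeriv critPt := by
    unfold paramPDeriv
    gcongr
  exact ⟨le_trans (by norm_num) h2, h1.trans (by norm_num)⟩

theorem bounds_of_sq_mul {c : ℝ} (hc : 0 < c)
    (h : c ^ 2 * secondDiff critPt critPt = phi critPt) : 0.29709808 ≤ c ∧ c ≤ 0.29709814 := by
  have hl := lt_critPt.le
  have hu := critPt_lt.le
  have h0 := critPt_pos
  have k1 : secondDiff critPt critPt ≤ secondDiff (0.232617924 : ℝ) 0.232617924 := by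
    unfold secondDiff
    gcongr
  have k2 : secondDiff (0.232617923 : ℝ) 0.232617923 ≤ secondDiff critPt critPt := by
    unfold secondDiff
    gcongr
  have p1 : phi critPt ≤ phi (0.232617924 : ℝ) := by
    unfold phi
    gcongr
  have p2 : phi (0.232617923 : ℝ) ≤ phi critPt := by
    unfold phi
    gcongr
  have hk : 0 < secondDiff critPt critPt := by
    unfold secondDiff
    positivity
  constructor
  · by_contra! hlt
    have h1 : c ^ 2 * secondDiff critPt critPt ≤
        0.29709808 ^ 2 * secondDiff (0.232617924 : ℝ) 0.232617924 := by gcongr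
    have h2 : 0.29709808 ^ 2 * secondDiff (0.232617924 : ℝ) 0.232617924 < phi (0.232617923 : ℝ) := by
      norm_num [secondDiff, phi]
    linarith
  · by_contra! hlt
    have h1 : 0.29709814 ^ 2 * secondDiff (0.232617923 : ℝ) 0.232617923 ≤
        c ^ 2 * secondDiff critPt critPt := by
      refine mul_le_mul (by gcongr) k2 (by norm_num [secondDiff]) (by positivity)
    have h2 : phi (0.232617924 : ℝ) < 0.29709814 ^ 2 * secondDiff (0.232617923 : ℝ) 0.232617923 := by
      norm_num [secondDiff, phi]
    linarith

theorem comp_param_spec {O : Set ℂ} {M N : ℂ → ℂ} {c d : ℝ} (hO : IsOpen O)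
    (hM : AnalyticOnNhd ℂ M O) (hMD : Set.MapsTo M O paramDomain) (hM0 : M 0 = critPt)
    (hM' : HasDerivAt M (-c) 0) (hN : DifferentiableOn ℂ N paramDomain)
    (hN' : HasDerivAt N d critPt) :
    AnalyticOnNhd ℂ (fun s => N (M s)) O ∧ N (M 0) = N critPt ∧
      deriv (fun s => N (M s)) 0 = -((d * c : ℝ) : ℂ) := by
  refine ⟨?_, by rw [hM0], ?_⟩
  · exact (hN.comp hM.differentiableOn hMD).analyticOnNhd hO
  · rw [← hM0] at hN'
    have := (hN'.comp (0 : ℂ) hM').deriv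
    rw [show (fun s => N (M s)) = N ∘ M from rfl, this]
    push_cast
    ring

end PlaneTree

open PlaneTree in
theorem mainTheorem7 :
    -- the polynomial equation for `s = SZ₂₂(z)`
    (∀ s z : PowerSeries ℤ, s = PlaneTree.genFun (fun T => T.sigma₂ * T.hosoya₂) →
      z = PowerSeries.X →
      s ^ 10 + 2 * z * s ^ 8 - 3 * z * s ^ 7 + z ^ 2 * s ^ 6 - 4 * z ^ 2 * s ^ 5
        + 3 * z ^ 2 * s ^ 4 - z ^ 3 * s ^ 3 + 2 * z ^ 3 * s ^ 2 - z ^ 3 * s + z ^ 4 = 0) ∧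
    ∃ z₀ a b A B C κ : ℝ,
      -- all decimals below are correctly rounded
      |z₀ - 0.0982673| ≤ 0.00000005 ∧
      |a - 0.171502| ≤ 0.0000005 ∧ |b - 0.138532| ≤ 0.0000005 ∧
      |A - 0.427020| ≤ 0.0000005 ∧ |B - 0.462827| ≤ 0.0000005 ∧
      |C - 0.92565| ≤ 0.000005 ∧ |κ - 2.54408| ≤ 0.000005 ∧
      C = 2 * B ∧ κ = 1 / (4 * z₀) ∧
      -- `SZ₂₂(z) ~ a - b √(1 - z / z₀)` and `SZ(z) ~ A - B √(1 - z / z₀)`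
      PlaneTree.HasDominantSqrtSingularity (fun T => T.sigma₂ * T.hosoya₂) z₀ a b ∧
      PlaneTree.HasDominantSqrtSingularity (fun T => T.sigma * T.hosoya) z₀ A B ∧
      -- `E(σₙ Zₙ) ~ C κ ^ n`
      (fun n : ℕ => PlaneTree.expectation (fun T => (T.sigma : ℝ) * (T.hosoya : ℝ)) n)
        ~[atTop] fun n : ℕ => C * κ ^ n := by
  refine ⟨fun s z => genFun_polynomial, ?_⟩
  obtain ⟨O, M, c, hO, hK, hM, hMD, hM0, hMz, hM', hc, hc2⟩ := exists_param_of_sqrt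
  obtain ⟨hc1, hc2⟩ := bounds_of_sq_mul hc hc2
  obtain ⟨hS1, hS2⟩ := paramSDeriv_critPt_bounds
  obtain ⟨hP1, hP2⟩ := paramPDeriv_critPt_bounds
  have hb1 := mul_le_mul hS1 hc1 (by norm_num) (by linarith)
  have hb2 := mul_le_mul hS2 hc2 hc.le (by linarith)
  have hB1 := mul_le_mul hP1 hc1 (by norm_num) (by linarith)
  have hB2 := mul_le_mul hP2 hc2 hc.le (by linarith)
  have hcrit : (critPt : ℂ) ∈ paramDomain := mem_paramDomain (by
    rw [Complex.norm_real, Real.norm_of_nonneg critPt_pos.le])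
  have castS : paramS (critPt : ℂ) = ((paramS critPt : ℝ) : ℂ) := by
    unfold paramS
    push_cast
    rfl
  have castP : paramP (critPt : ℂ) = ((paramP critPt : ℝ) : ℂ) := by
    unfold paramP
    push_cast
    rfl
  have castS' : paramSDeriv (critPt : ℂ) = ((paramSDeriv critPt : ℝ) : ℂ) := by
    unfold paramSDeriv
    push_cast
    rfl
  have castP' : paramPDeriv (critPt : ℂ) = ((paramPDeriv critPt : ℝ) : ℂ) := by
    unfold paramPDeriv
    push_cast
    rfl
  obtain ⟨anS, valS, derS⟩ := comp_param_spec hO hM hMD hM0 hM' (N := paramS)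
    (fun m hm => (hasDerivAt_paramS hm).differentiableAt.differentiableWithinAt)
    (castS' ▸ hasDerivAt_paramS hcrit)
  obtain ⟨anP, valP, derP⟩ := comp_param_spec hO hM hMD hM0 hM' (N := paramP)
    (fun m hm => (hasDerivAt_paramP hm).differentiableAt.differentiableWithinAt)
    (castP' ▸ hasDerivAt_paramP hcrit)
  have sumS : ∀ z : ℂ, ‖z‖ < critVal → HasSum (fun T : PlaneTree => (wS T : ℂ) * z ^ T.size)
      (paramS (M ((1 - z / critVal) ^ (1 / 2 : ℂ)))) := fun z hz => by
    rw [hMz z hz.le, ← (param_spec hz.le).2.1]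
    exact hasSum_gf summable_wS hz.le
  have sumP : ∀ z : ℂ, ‖z‖ < critVal → HasSum (fun T : PlaneTree => (wP T : ℂ) * z ^ T.size)
      (paramP (M ((1 - z / critVal) ^ (1 / 2 : ℂ)))) := fun z hz => by
    rw [hMz z hz.le, ← (param_spec hz.le).2.2]
    exact hasSum_gf summable_wP_and_le.1 hz.le
  have hb0 : paramSDeriv critPt * c ≠ 0 := by
    norm_num at hb1
    exact (lt_of_lt_of_le (by norm_num) hb1).ne'
  have hB0 : paramPDeriv critPt * c ≠ 0 := by
    norm_num at hB1
    exact (lt_of_lt_of_le (by norm_num) hB1).ne'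
  norm_num at hb1 hb2 hB1 hB2
  refine ⟨critVal, paramS critPt, paramSDeriv critPt * c, paramP critPt, paramPDeriv critPt * c,
    2 * (paramPDeriv critPt * c), 1 / (4 * critVal), critVal_bounds.1, paramS_critPt_bounds,
    abs_le.2 ⟨?_, ?_⟩, paramP_critPt_bounds, abs_le.2 ⟨?_, ?_⟩, abs_le.2 ⟨?_, ?_⟩,
    critVal_bounds.2, rfl, rfl,
    hasDominantSqrtSingularity_of_sqrt critVal_pos hb0 hO hK anS (valS.trans castS) derS sumS,
    hasDominantSqrtSingularity_of_sqrt critVal_pos hB0 hO hK anP (valP.trans castP) derP sumP, ?_⟩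
  any_goals linarith
  have h := expectation_isEquivalent critVal_pos hB0 hO hK anP.differentiableOn derP sumP
  refine h.congr_left (Eventually.of_forall fun n => ?_)
  simp only [wP, Nat.cast_mul]
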